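/- Let $k$ be a commutative ring and let $\mathcal A$ be a $k$-linear abelian category. Let $\mathcal C$ be the differential graded category of (unbounded) complexes in $\mathcal A$, let $\mathcal B\subset\mathcal C$ be the full subcategory of acyclic complexes, and let $\mathcal D=\mathsf Q(\mathcal C|\mathcal B)$ be the quotient $A_\infty$-category, constructed as follows (maps act on the right, $s\mathcal C=\mathcal C[1]$, and $b_n$ denotes the $n$-ary operation on the shifted morphism modules, of degree $1$). * A labeled tree from $X$ to $Y$ is a plane rooted tree with $n\ge1$ leaves, in which no two unary vertices are joined by an edge, together with objects $X=X_0,X_1,\dots,X_n=Y$ of $\mathcal C$. It is admissible if for every unary vertex the leaves above it are those numbered $i,\dots,j$ with $X_{i-1}\in\mathcal B$ or $X_j\in\mathcal B$. Let $s\mathcal E(X,Y)$ be the direct sum, over all admissible trees $t$ from $X$ to $Y$, of $s\mathcal C(X_0,X_1)\otimes_k\dots\otimes_k s\mathcal C(X_{n-1},X_n)[|t|_1-|t|_>]$, where $|t|_1$ and $|t|_>$ are the numbers of internal vertices of arity $1$ and of arity $>1$. * For $p\ge2$ the operation $b_p$ of $\mathcal E$ is grafting of $p$ trees to a $p$-ary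 vertex (of degree $1$), and $H$ is grafting of a tree, whose lowest vertex is not unary, to a unary vertex (of degree $-1$). The differential $b_1$ of $\mathcal E$ extends the differential $b_1$ of $s\mathcal C$ and is determined by $Hb_1=1-b_1H$ and $b_pb_1=-\sum_{\alpha+q+\beta=p,\ \alpha+\beta>0}(1^{\otimes\alpha}\otimes b_q\otimes1^{\otimes\beta})b_{\alpha+1+\beta}$ for $p\ge2$. * $s\mathcal D=s\mathcal E/(R_{\mathcal C})_+$, where $(R_{\mathcal C})_+$ is the submodule closed under $H$ and under all $b_p$, $p\ge2$ (applied with one argument in it), generated by the elements $(x_1\otimes\dots\otimes x_p)b_p^{\mathcal E}-(x_1\otimes\dots\otimes x_p)b_p^{\mathcal C}$ with $x_i$ in $s\mathcal C$ and $p\ge2$. Here $(xs\otimes ys)b_2^{\mathcal C}=(-1)^{|y|}(xy)s$ and $b_p^{\mathcal C}=0$ for $p\ge3$. Let $H^0\mathcal C$ be the homotopy category of complexes in $\mathcal A$. Let $H^0\mathcal D$ be the category with the same objects whose morphisms $X\to Y$ are the elements of the degree $0$ cohomology of $\mathcal D(X,Y)$, with composition induced by $b_2$ and with the classes of the identities of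 $\mathcal C$ as identities. Let $H^0e:H^0\mathcal C\to H^0\mathcal D$ be the functor which is the identity on objects and is induced on morphisms by the embedding $e$ of $\mathcal C$ in $\mathcal D$ as the summands of the trivial trees. Then: 1. For every quasi-isomorphism $q:X\to Y$ of complexes, the image of its homotopy class under $H^0e$ is an isomorphism in $H^0\mathcal D$. 2. The Verdier quotient $H^0\mathcal C/H^0\mathcal B$ is the derived category $D(\mathcal A)$: there is an equivalence between them that is compatible, up to isomorphism, with the canonical functors from $H^0\mathcal C$. 3. The functor $H^0e$ factors as $H^0\mathcal C\xrightarrow{Q_{\mathrm{Verdier}}}H^0\mathcal C/H^0\mathcal B\xrightarrow{\,g\,}H^0\mathcal D$, where the functor $g$ is the identity on objects. -/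

import Mathlib

open CategoryTheory

universe t w v u

set_option linter.unusedSectionVars false
set_option linter.unusedSimpArgs false

noncomputable section

/-- A differential graded category over `k` with class of objects `Ob`.  Composition is written in
the order of the arrows and the differential acts from the right, so the Leibniz rule reads
`d (x y) = x (d y) + (-1) ^ |y| (d x) y`.  `Hom X Y n` is the component of degree `n`. -/
structure DGCat (k : Type w) [CommRing k] (Ob : Type u) where
  Hom : Ob → Ob → ℤ → Type v
  [acg : ∀ X Y n, AddCommGroup (Hom X Y n)]
  [mod : ∀ X Y n, Module k (Hom X Y n)]
  d : ∀ {X Y : Ob} (n m : ℤ), n + 1 = m → Hom X Y n →ₗ[k] Hom X Y m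
  comp : ∀ {X Y Z : Ob} {m n l : ℤ}, m + n = l → Hom X Y m →ₗ[k] Hom Y Z n →ₗ[k] Hom X Z l
  one : ∀ X : Ob, Hom X X 0
  d_d : ∀ {X Y : Ob} (n m l : ℤ) (h : n + 1 = m) (h' : m + 1 = l) (f : Hom X Y n),
    d m l h' (d n m h f) = 0
  leibniz : ∀ {X Y Z : Ob} {m n l m' n' l' : ℤ} (h : m + n = l) (hm : m + 1 = m')
    (hn : n + 1 = n') (hl : l + 1 = l') (h₁ : m + n' = l') (h₂ : m' + n = l')
    (f : Hom X Y m) (g : Hom Y Z n),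
    d l l' hl (comp h f g) = comp h₁ f (d n n' hn g) + n.negOnePow • comp h₂ (d m m' hm f) g
  assoc : ∀ {X Y Z W : Ob} {a b c ab bc l : ℤ} (h₁ : a + b = ab) (h₂ : b + c = bc)
    (h₃ : ab + c = l) (h₄ : a + bc = l) (f : Hom X Y a) (g : Hom Y Z b) (h : Hom Z W c),
    comp h₃ (comp h₁ f g) h = comp h₄ f (comp h₂ g h)
  one_comp : ∀ {X Y : Ob} {n : ℤ} (f : Hom X Y n), comp (zero_add n) (one X) f = f
  comp_one : ∀ {X Y : Ob} {n : ℤ} (f : Hom X Y n), comp (add_zero n) f (one Y) = f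

attribute [instance] DGCat.acg DGCat.mod

namespace DGCat

variable {k : Type w} [CommRing k] {Ob : Type u}

theorem d_one (C : DGCat.{w, v, u} k Ob) (X : Ob) : C.d 0 1 (zero_add 1) (C.one X) = 0 := by
  have h := C.leibniz (zero_add 0) (zero_add 1) (zero_add 1) (zero_add 1) (zero_add 1)
    (add_zero 1) (C.one X) (C.one X)
  rw [C.one_comp, C.one_comp, C.comp_one] at h
  simpa using h

/-- The differential graded category of (unbounded cochain) complexes in `A`: a morphism of degree
`n` is a family of maps `K^p → L^q`, `p + n = q`, and in the order of the arrows
`d z = z d_L - (-1) ^ n d_K z`. -/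
def complexes (k : Type w) [CommRing k] (A : Type u) [Category.{v} A] [Abelian A] [Linear k A] :
    DGCat.{w, v, max u v} k (CochainComplex A ℤ) where
  Hom K L n := CochainComplex.HomComplex.Cochain K L n
  d n m _ := CochainComplex.HomComplex.δ_hom k _ _ n m
  comp h := LinearMap.mk₂ k (fun f g => f.comp g h)
    (fun _ _ _ => CochainComplex.HomComplex.Cochain.add_comp _ _ _ _)
    (fun _ _ _ => CochainComplex.HomComplex.Cochain.smul_comp _ _ _ _)
    (fun _ _ _ => CochainComplex.HomComplex.Cochain.comp_add _ _ _ _)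
    (fun _ _ _ => CochainComplex.HomComplex.Cochain.comp_smul _ _ _ _)
  one K := CochainComplex.HomComplex.Cochain.ofHom (𝟙 K)
  d_d n m l _ _ f := CochainComplex.HomComplex.δ_δ n m l f
  leibniz h hm hn hl h₁ h₂ f g := CochainComplex.HomComplex.δ_comp f g h _ _ _ hl hm hn
  assoc h₁ h₂ h₃ h₄ f g h :=
    CochainComplex.HomComplex.Cochain.comp_assoc f g h h₁ h₂ (by omega)
  one_comp f := CochainComplex.HomComplex.Cochain.id_comp f
  comp_one f := CochainComplex.HomComplex.Cochain.comp_id f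

/-- The two kinds of combinatorial objects: plane rooted trees, and nonempty forests of such. -/
inductive Kind
  | tree
  | forest

/-- Tree monomials.  A term of `T C B .tree X Y` is a plane rooted tree with `n ≥ 1` leaves, together
with objects `X = X₀, X₁, …, Xₙ = Y` and with its `i`-th leaf labelled by a homogeneous morphism
`X_{i-1} → X_i` of `C`.
* `leaf n f` is the trivial tree labelled by `f`, an element of `sC(X, Y)` of degree `n - 1`;
* `hmt h t` is `t` with a unary vertex (the contracting homotopy `H`) grafted below it, which
  requires the source or the target to be in `B`;
* `node t (t₂, …, tₚ)` is the grafting of the trees `t, t₂, …, tₚ`, `p ≥ 2`, to a `p`-ary vertex, that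
  is `(t ⊗ t₂ ⊗ … ⊗ tₚ) bₚ`.
A term of `T C B .forest X Y` is a nonempty sequence `t₁ ⊗ … ⊗ tₚ` of composable trees.  Two unary
vertices joined by an edge are allowed at this stage; such trees are set to zero below. -/
inductive T (C : DGCat.{w, v, u} k Ob) (B : Ob → Prop) : Kind → Ob → Ob → Type max u v
  | leaf {X Y : Ob} (n : ℤ) (f : C.Hom X Y n) : T C B .tree X Y
  | hmt {X Y : Ob} (h : B X ∨ B Y) (t : T C B .tree X Y) : T C B .tree X Y
  | node {X Y Z : Ob} (t : T C B .tree X Y) (F : T C B .forest Y Z) : T C B .tree X Z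
  | sing {X Y : Ob} (t : T C B .tree X Y) : T C B .forest X Y
  | cons {X Y Z : Ob} (t : T C B .tree X Y) (F : T C B .forest Y Z) : T C B .forest X Z

namespace T

variable {C : DGCat.{w, v, u} k Ob} {B : Ob → Prop}

/-- The degree in the shifted module: the leaves have the degree of `sC = C[1]`, vertices of arity
`≥ 2` have degree `1`, and unary vertices have degree `-1`. -/
def deg : ∀ {κ : Kind} {X Y : Ob}, T C B κ X Y → ℤ
  | _, _, _, leaf n _ => n - 1
  | _, _, _, hmt _ t => deg t - 1
  | _, _, _, node t F => deg t + deg F + 1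
  | _, _, _, sing t => deg t
  | _, _, _, cons t F => deg t + deg F

/-- The sum of `φ F' F''` over all ways of writing the forest `F = F' ⊗ F''` with `F'`, `F''` both
nonempty. -/
def splitSum {M : Type*} [AddCommMonoid M] : ∀ {κ : Kind} {X Y : Ob}, T C B κ X Y →
    (∀ Z : Ob, T C B .forest X Z → T C B .forest Z Y → M) → M
  | _, _, _, leaf _ _, _ => 0
  | _, _, _, hmt _ _, _ => 0
  | _, _, _, node _ _, _ => 0
  | _, _, _, sing _, _ => 0
  | _, _, _, cons t F, φ => φ _ (sing t) F + splitSum F (fun Z F' F'' => φ Z (cons t F') F'')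

/-- All trees of the forest are trivial, that is, the forest is a pure tensor in `sC ⊗ … ⊗ sC`. -/
def AllLeaves : ∀ {κ : Kind} {X Y : Ob}, T C B κ X Y → Prop
  | _, _, _, leaf _ _ => True
  | _, _, _, hmt _ _ => False
  | _, _, _, node _ _ => False
  | _, _, _, sing t => AllLeaves t
  | _, _, _, cons t F => AllLeaves t ∧ AllLeaves F

end T

section

variable (C : DGCat.{w, v, u} k Ob) (B : Ob → Prop)

/-- The free module on the tree monomials (or forest monomials) from `X` to `Y`. -/
def E (κ : Kind) (X Y : Ob) := T C B κ X Y →₀ k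

instance instAddCommGroupE (κ : Kind) (X Y : Ob) : AddCommGroup (E C B κ X Y) :=
  inferInstanceAs (AddCommGroup (T C B κ X Y →₀ k))

instance instModuleE (κ : Kind) (X Y : Ob) : Module k (E C B κ X Y) :=
  inferInstanceAs (Module k (T C B κ X Y →₀ k))

variable {C B}

/-- The basis vector of a monomial. -/
def bas {κ : Kind} {X Y : Ob} (t : T C B κ X Y) : E C B κ X Y := Finsupp.single t 1

/-- The sign `(-1) ^ n` in `k`. -/
def sgn (k : Type w) [CommRing k] (n : ℤ) : k := ((n.negOnePow : ℤ) : k)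

/-- Linear extension of a map given on monomials. -/
def lin {κ : Kind} {X Y : Ob} {M : Type*} [AddCommGroup M] [Module k M] (f : T C B κ X Y → M) :
    E C B κ X Y →ₗ[k] M :=
  Finsupp.linearCombination k f

/-- Bilinear extension of a map given on pairs of monomials. -/
def bilin {κ κ' : Kind} {X Y X' Y' : Ob} {M : Type*} [AddCommGroup M] [Module k M]
    (f : T C B κ X Y → T C B κ' X' Y' → M) : E C B κ X Y →ₗ[k] E C B κ' X' Y' →ₗ[k] M :=
  lin (fun s => lin (f s))

/-- The contracting homotopy `H`, of degree `-1`. -/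
def hmtE {X Y : Ob} (h : B X ∨ B Y) : E C B .tree X Y →ₗ[k] E C B .tree X Y :=
  lin (fun t => bas (.hmt h t))

/-- The operations `bₚ`, `p ≥ 2`: the grafting of `x ⊗ y` where `y` is a forest of length `p - 1`. -/
def nodeE {X Y Z : Ob} : E C B .tree X Y →ₗ[k] E C B .forest Y Z →ₗ[k] E C B .tree X Z :=
  bilin (fun t F => bas (.node t F))

/-- A tree, regarded as a forest of length one. -/
def singE {X Y : Ob} : E C B .tree X Y →ₗ[k] E C B .forest X Y :=
  lin (fun t => bas (.sing t))

/-- `x ⊗ y` for a tree `x` and a forest `y`. -/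
def consE {X Y Z : Ob} : E C B .tree X Y →ₗ[k] E C B .forest Y Z →ₗ[k] E C B .forest X Z :=
  bilin (fun t F => bas (.cons t F))

/-- The differential, on monomials.  All maps act from the right, so `1 ⊗ f` acts on `x ⊗ y` without
sign, and `(x ⊗ y) (f ⊗ 1) = (-1) ^ (|f| |y|) x f ⊗ y`.
* On trees it is `b₁`.  It extends the differential of `C`, and it is determined recursively by
  `H b₁ = 1 - b₁ H` and, for `k ≥ 2`,
  `b_k b₁ = - ∑ (1^{⊗α} ⊗ bₚ ⊗ 1^{⊗β}) b_{α+1+β}`, the sum over `α + p + β = k`, `p ≥ 1`, `α + β > 0`.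
* On a forest of length `k` it is the bar differential
  `∑ 1^{⊗α} ⊗ bₚ ⊗ 1^{⊗β}`, the sum over `α + p + β = k`, `p ≥ 1` (so that `p = k` is included).
In the clause for `node t F` the tensor `t ⊗ F` is acted upon by the terms with `α ≥ 1` (the first
summand; these are all the terms of the bar differential of `F`), those with `α = 0`, `p = 1` (the
second), and those with `α = 0`, `2 ≤ p < k` (the third).  In the clause for `cons t F` the last
summand is the term `α = β = 0`. -/
def dT : ∀ {κ : Kind} {X Y : Ob}, T C B κ X Y → E C B κ X Y
  | _, _, _, .leaf n f => bas (.leaf (n + 1) (C.d n (n + 1) rfl f))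
  | _, _, _, .hmt h t => bas t - hmtE h (dT t)
  | _, _, _, .node t F =>
      -(nodeE (bas t) (dT F) + sgn k F.deg • nodeE (dT t) (bas F) +
        T.splitSum F (fun _ F' F'' => sgn k F''.deg • bas (.node (.node t F') F'')))
  | _, _, _, .sing t => singE (dT t)
  | _, _, _, .cons t F =>
      consE (bas t) (dT F) + sgn k F.deg • consE (dT t) (bas F) +
        T.splitSum F (fun _ F' F'' => sgn k F''.deg • bas (.cons (.node t F') F'')) +
        bas (.sing (.node t F))

/-- The differential `b₁` (on trees) and the bar differential (on forests). -/
def dE {κ : Kind} {X Y : Ob} : E C B κ X Y →ₗ[k] E C B κ X Y := lin dT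

/-- The smallest family of submodules that is closed under `H`, under the operations `bₚ`, `p ≥ 2`, and
under tensoring, and that contains
* the relations `leaf_add`, `leaf_smul`, which make a tree monomial multilinear in the labels of its
  leaves: dividing by them gives the tensor products `sC(X₀, X₁) ⊗ … ⊗ sC(X_{n-1}, X_n)`, shifted,
  as the summands of `sE`;
* the relation `hmt_hmt`, which kills the trees with two unary vertices joined by an edge, so that
  only the admissible trees remain;
* the relations `mul_two`, `mul_many`, which say that `bₚ` of `E` restricted to `(sC)^{⊗p}` is `bₚ` of
  the differential graded category `C`: it is `(xs ⊗ ys) b₂ = (-1) ^ |y| (xy) s` for `p = 2`, and zero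
  for `p ≥ 3`. -/
inductive Rel : ∀ {κ : Kind} {X Y : Ob}, E C B κ X Y → Prop
  | leaf_add {X Y : Ob} (n : ℤ) (f g : C.Hom X Y n) :
      Rel (bas (.leaf n (f + g)) - (bas (.leaf n f) + bas (.leaf n g)))
  | leaf_smul {X Y : Ob} (n : ℤ) (c : k) (f : C.Hom X Y n) :
      Rel (bas (.leaf n (c • f)) - c • bas (.leaf n f))
  | hmt_hmt {X Y : Ob} (h h' : B X ∨ B Y) (t : T C B .tree X Y) :
      Rel (bas (.hmt h (.hmt h' t)))
  | mul_two {X Y Z : Ob} (m n : ℤ) (f : C.Hom X Y m) (g : C.Hom Y Z n) :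
      Rel (bas (.node (.leaf m f) (.sing (.leaf n g))) -
        sgn k n • bas (.leaf (m + n) (C.comp rfl f g)))
  | mul_many {X Y Z W : Ob} (m n : ℤ) (f : C.Hom X Y m) (g : C.Hom Y Z n)
      (F : T C B .forest Z W) (hF : F.AllLeaves) :
      Rel (bas (.node (.leaf m f) (.cons (.leaf n g) F)))
  | zero {κ : Kind} {X Y : Ob} : Rel (0 : E C B κ X Y)
  | add {κ : Kind} {X Y : Ob} (x y : E C B κ X Y) : Rel x → Rel y → Rel (x + y)
  | smul {κ : Kind} {X Y : Ob} (c : k) (x : E C B κ X Y) : Rel x → Rel (c • x)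
  | hmt {X Y : Ob} (h : B X ∨ B Y) (x : E C B .tree X Y) : Rel x → Rel (hmtE h x)
  | node_left {X Y Z : Ob} (x : E C B .tree X Y) (y : E C B .forest Y Z) :
      Rel x → Rel (nodeE x y)
  | node_right {X Y Z : Ob} (x : E C B .tree X Y) (y : E C B .forest Y Z) :
      Rel y → Rel (nodeE x y)
  | sing {X Y : Ob} (x : E C B .tree X Y) : Rel x → Rel (singE x)
  | cons_left {X Y Z : Ob} (x : E C B .tree X Y) (y : E C B .forest Y Z) :
      Rel x → Rel (consE x y)
  | cons_right {X Y Z : Ob} (x : E C B .tree X Y) (y : E C B .forest Y Z) :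
      Rel y → Rel (consE x y)

/-- The submodule spanned by the relations; in particular this contains the ideal `(R_C)₊`. -/
def ideal (C : DGCat.{w, v, u} k Ob) (B : Ob → Prop) (κ : Kind) (X Y : Ob) : Submodule k (E C B κ X Y) where
  carrier := {x | Rel x}
  zero_mem' := .zero
  add_mem' h h' := .add _ _ h h'
  smul_mem' c _ h := .smul c _ h

/-! ### Auxiliary facts -/
section lemmas

@[simp] theorem sgn_zero : sgn k 0 = 1 := by simp [sgn]
theorem sgn_add (m n : ℤ) : sgn k (m + n) = sgn k m * sgn k n := by
  simp [sgn, Int.negOnePow_add]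
theorem sgn_sub (m n : ℤ) : sgn k (m - n) = sgn k m * sgn k n := by
  simp [sgn, Int.negOnePow_sub]
@[simp] theorem sgn_one : sgn k 1 = -1 := by simp [sgn]
@[simp] theorem sgn_neg_one : sgn k (-1) = -1 := by simp [sgn]
theorem sgn_mul_self (n : ℤ) : sgn k n * sgn k n = 1 := by
  rw [← sgn_add, sgn, Int.negOnePow_even _ (Even.add_self n)]; simp
theorem negOnePow_smul {M : Type*} [AddCommGroup M] [Module k M] (n : ℤ) (x : M) :
    n.negOnePow • x = sgn k n • x := by
  rw [sgn, Int.cast_smul_eq_zsmul, Units.smul_def]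

section
variable {M : Type*} [AddCommGroup M] [Module k M] {κ κ' : Kind} {X Y X' Y' : Ob}

@[simp] theorem lin_bas (f : T C B κ X Y → M) (s : T C B κ X Y) : lin f (bas s) = f s :=
  (Finsupp.linearCombination_single _ _ _).trans (one_smul _ _)

@[simp] theorem bilin_bas (f : T C B κ X Y → T C B κ' X' Y' → M)
    (s : T C B κ X Y) (s' : T C B κ' X' Y') : bilin f (bas s) (bas s') = f s s' := by
  simp [bilin]

theorem bas_ind {p : E C B κ X Y → Prop} (x : E C B κ X Y) (h0 : p 0)
    (hadd : ∀ x y, p x → p y → p (x + y)) (hsmul : ∀ (c : k) x, p x → p (c • x))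
    (hb : ∀ s, p (bas s)) : p x := by
  refine Finsupp.induction_linear (motive := p) x h0 (fun f g hf hg => hadd f g hf hg)
    (fun s c => ?_)
  have h := hsmul c _ (hb s)
  have e : c • bas (B := B) s = (Finsupp.single s c : T C B κ X Y →₀ k) :=
    (Finsupp.smul_single _ _ _).trans (by rw [smul_eq_mul, mul_one])
  exact e ▸ h

theorem lin_ext {f g : E C B κ X Y →ₗ[k] M} (h : ∀ s, f (bas s) = g (bas s)) (x : E C B κ X Y) :
    f x = g x := by
  induction x using bas_ind with
  | h0 => simp
  | hadd x y hx hy => simp [hx, hy]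
  | hsmul c x hx => simp [hx]
  | hb s => exact h s

end

@[simp] theorem hmtE_bas {X Y : Ob} (h : B X ∨ B Y) (t : T C B .tree X Y) :
    hmtE h (bas t) = bas (.hmt h t) := by simp [hmtE]
@[simp] theorem nodeE_bas {X Y Z : Ob} (t : T C B .tree X Y) (F : T C B .forest Y Z) :
    nodeE (bas t) (bas F) = bas (.node t F) := by simp [nodeE]
@[simp] theorem consE_bas {X Y Z : Ob} (t : T C B .tree X Y) (F : T C B .forest Y Z) :
    consE (bas t) (bas F) = bas (.cons t F) := by simp [consE]
@[simp] theorem singE_bas {X Y : Ob} (t : T C B .tree X Y) :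
    singE (bas t) = bas (.sing t) := by simp [singE]
@[simp] theorem dE_bas {κ : Kind} {X Y : Ob} (t : T C B κ X Y) : dE (bas t) = dT t := by
  simp [dE]

/-- The operator that multiplies an element of degree `n` by `(-1) ^ n`. -/
def sgE {κ : Kind} {X Y : Ob} : E C B κ X Y →ₗ[k] E C B κ X Y := lin (fun t => sgn k t.deg • bas t)

@[simp] theorem sgE_bas {κ : Kind} {X Y : Ob} (t : T C B κ X Y) :
    sgE (bas t) = sgn k t.deg • bas t := by simp [sgE]

section split
variable {M N : Type*} [AddCommGroup M] [Module k M] [AddCommGroup N] [Module k N]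

theorem split_map (f : M →ₗ[k] N) {κ : Kind} {X Y : Ob} (t : T C B κ X Y)
    (φ : ∀ Z : Ob, T C B .forest X Z → T C B .forest Z Y → M) :
    f (t.splitSum φ) = t.splitSum (fun Z F' F'' => f (φ Z F' F'')) := by
  induction t with
  | leaf => simp [T.splitSum]
  | hmt => simp [T.splitSum]
  | node => simp [T.splitSum]
  | sing => simp [T.splitSum]
  | cons t F ht hF => simp [T.splitSum, hF]

theorem split_add {κ : Kind} {X Y : Ob} (t : T C B κ X Y)
    (φ ψ : ∀ Z : Ob, T C B .forest X Z → T C B .forest Z Y → M) :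
    t.splitSum (fun Z F' F'' => φ Z F' F'' + ψ Z F' F'') = t.splitSum φ + t.splitSum ψ := by
  induction t with
  | leaf => simp [T.splitSum]
  | hmt => simp [T.splitSum]
  | node => simp [T.splitSum]
  | sing => simp [T.splitSum]
  | cons t F ht hF => simp only [T.splitSum, hF]; abel

theorem split_smul {κ : Kind} {X Y : Ob} (t : T C B κ X Y) (c : k)
    (φ : ∀ Z : Ob, T C B .forest X Z → T C B .forest Z Y → M) :
    t.splitSum (fun Z F' F'' => c • φ Z F' F'') = c • t.splitSum φ :=
  (split_map (c • LinearMap.id : M →ₗ[k] M) t φ).symm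

theorem split_zero {κ : Kind} {X Y : Ob} (t : T C B κ X Y) :
    t.splitSum (fun _ _ _ => (0 : M)) = 0 := by
  induction t with
  | leaf => simp [T.splitSum]
  | hmt => simp [T.splitSum]
  | node => simp [T.splitSum]
  | sing => simp [T.splitSum]
  | cons t F ht hF => simp [T.splitSum, hF]

theorem split_mem (N : Submodule k M) {κ : Kind} {X Y : Ob} (t : T C B κ X Y)
    (φ : ∀ Z : Ob, T C B .forest X Z → T C B .forest Z Y → M) (h : ∀ Z F F', φ Z F F' ∈ N) :
    t.splitSum φ ∈ N := by
  induction t with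
  | leaf => simp [T.splitSum]
  | hmt => simp [T.splitSum]
  | node => simp [T.splitSum]
  | sing => simp [T.splitSum]
  | cons t F ht hF => exact N.add_mem (h _ _ _) (hF _ (fun _ _ _ => h _ _ _))

theorem split_congr {κ : Kind} {X Y : Ob} (t : T C B κ X Y)
    (φ ψ : ∀ Z : Ob, T C B .forest X Z → T C B .forest Z Y → M)
    (h : ∀ Z (F : T C B .forest X Z) F', F.deg + F'.deg = t.deg → φ Z F F' = ψ Z F F') :
    t.splitSum φ = t.splitSum ψ := by
  induction t with
  | leaf => simp [T.splitSum]
  | hmt => simp [T.splitSum]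
  | node => simp [T.splitSum]
  | sing => simp [T.splitSum]
  | cons t F ht hF =>
    simp only [T.splitSum]
    rw [h _ _ _ (by simp [T.deg]), hF _ _ (fun Z F' F'' hd => h _ _ _ (by simp [T.deg]; omega))]

theorem split_mem_leaves (N : Submodule k M) {κ : Kind} {X Y : Ob} (t : T C B κ X Y)
    (ht : t.AllLeaves)
    (φ : ∀ Z : Ob, T C B .forest X Z → T C B .forest Z Y → M)
    (h : ∀ Z F F', F.AllLeaves → F'.AllLeaves → φ Z F F' ∈ N) :
    t.splitSum φ ∈ N := by
  induction t with
  | leaf => simp [T.splitSum]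
  | hmt => simp [T.splitSum]
  | node => simp [T.splitSum]
  | sing => simp [T.splitSum]
  | cons t F _ hF =>
    exact N.add_mem (h _ _ _ ht.1 ht.2) (hF ht.2 _ (fun _ _ _ h1 h2 => h _ _ _ ⟨ht.1, h1⟩ h2))

end split

/-- The linear extension of a signed sum over splittings. -/
def Lsp {κ κ' : Kind} {X Y W : Ob}
    (c : ∀ Z, E C B .tree W Z →ₗ[k] E C B .forest Z Y →ₗ[k] E C B κ' W Y)
    (Φ : ∀ Z, E C B .forest X Z →ₗ[k] E C B .tree W Z) :
    E C B κ X Y →ₗ[k] E C B κ' W Y :=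
  lin (fun t => t.splitSum (fun Z F' F'' => sgn k F''.deg • c Z (Φ Z (bas F')) (bas F'')))

@[simp] theorem Lsp_bas {κ κ' : Kind} {X Y W : Ob}
    (c : ∀ Z, E C B .tree W Z →ₗ[k] E C B .forest Z Y →ₗ[k] E C B κ' W Y)
    (Φ : ∀ Z, E C B .forest X Z →ₗ[k] E C B .tree W Z) (t : T C B κ X Y) :
    Lsp c Φ (bas t) =
      t.splitSum (fun Z F' F'' => sgn k F''.deg • c Z (Φ Z (bas F')) (bas F'')) := by
  simp [Lsp]

theorem dE_hmtE {X Y : Ob} (h : B X ∨ B Y) (x : E C B .tree X Y) :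
    dE (hmtE h x) = x - hmtE h (dE x) := by
  refine lin_ext (f := dE ∘ₗ hmtE h) (g := LinearMap.id - hmtE h ∘ₗ dE) (fun t => ?_) x
  simp [dT]

theorem dE_singE {X Y : Ob} (x : E C B .tree X Y) : dE (singE x) = singE (dE x) := by
  refine lin_ext (f := dE ∘ₗ singE) (g := singE ∘ₗ dE) (fun t => ?_) x
  simp [dT]

theorem Lsp_add_right {κ κ' : Kind} {X Y W : Ob}
    (c : ∀ Z, E C B .tree W Z →ₗ[k] E C B .forest Z Y →ₗ[k] E C B κ' W Y)
    (Φ Ψ : ∀ Z, E C B .forest X Z →ₗ[k] E C B .tree W Z) (x : E C B κ X Y) :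
    Lsp c (fun Z => Φ Z + Ψ Z) x = Lsp c Φ x + Lsp c Ψ x := by
  refine lin_ext (g := Lsp c Φ + Lsp c Ψ) (fun t => ?_) x
  simp [← split_add]

theorem Lsp_smul_right {κ κ' : Kind} {X Y W : Ob}
    (c : ∀ Z, E C B .tree W Z →ₗ[k] E C B .forest Z Y →ₗ[k] E C B κ' W Y) (a : k)
    (Φ : ∀ Z, E C B .forest X Z →ₗ[k] E C B .tree W Z) (x : E C B κ X Y) :
    Lsp c (fun Z => a • Φ Z) x = a • Lsp c Φ x := by
  refine lin_ext (g := a • Lsp c Φ) (fun t => ?_) x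
  simp only [Lsp_bas, LinearMap.smul_apply, map_smul, ← split_smul]
  congr! 4
  rw [smul_comm]

theorem Lsp_zero_right {κ κ' : Kind} {X Y W : Ob}
    (c : ∀ Z, E C B .tree W Z →ₗ[k] E C B .forest Z Y →ₗ[k] E C B κ' W Y) (x : E C B κ X Y) :
    Lsp (X := X) c (fun _ => 0) x = 0 := by
  refine lin_ext (g := 0) (fun t => ?_) x
  simp [split_zero]

theorem dE_nodeE {X Y Z : Ob} (x : E C B .tree X Y) (y : E C B .forest Y Z) :
    dE (nodeE x y) =
      -(nodeE x (dE y) + nodeE (dE x) (sgE y) + Lsp (fun _ => nodeE) (fun _ => nodeE x) y) := by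
  induction x using bas_ind with
  | h0 => simp [Lsp_zero_right]
  | hadd x x' hx hx' =>
    simp only [map_add, LinearMap.add_apply, hx, hx', Lsp_add_right]; abel
  | hsmul a x hx =>
    simp only [map_smul, LinearMap.smul_apply, hx, Lsp_smul_right]; module
  | hb t =>
    refine lin_ext (f := dE ∘ₗ nodeE (bas t)) (g := -(nodeE (bas t) ∘ₗ dE +
      nodeE (dE (bas t)) ∘ₗ sgE + Lsp (fun _ => nodeE) (fun _ => nodeE (bas t)))) (fun F => ?_) y
    simp [dT]

theorem dE_consE {X Y Z : Ob} (x : E C B .tree X Y) (y : E C B .forest Y Z) :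
    dE (consE x y) =
      consE x (dE y) + consE (dE x) (sgE y) + Lsp (fun _ => consE) (fun _ => nodeE x) y +
        singE (nodeE x y) := by
  induction x using bas_ind with
  | h0 => simp [Lsp_zero_right]
  | hadd x x' hx hx' =>
    simp only [map_add, LinearMap.add_apply, hx, hx', Lsp_add_right]; abel
  | hsmul a x hx =>
    simp only [map_smul, LinearMap.smul_apply, hx, Lsp_smul_right]; module
  | hb t =>
    refine lin_ext (f := dE ∘ₗ consE (bas t)) (g := consE (bas t) ∘ₗ dE +
      consE (dE (bas t)) ∘ₗ sgE + Lsp (fun _ => consE) (fun _ => nodeE (bas t)) +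
      singE ∘ₗ nodeE (bas t)) (fun F => ?_) y
    simp [dT]

theorem sgE_hmtE {X Y : Ob} (h : B X ∨ B Y) (x : E C B .tree X Y) :
    sgE (hmtE h x) = - hmtE h (sgE x) := by
  refine lin_ext (f := sgE ∘ₗ hmtE h) (g := -((hmtE h : E C B .tree X Y →ₗ[k] _) ∘ₗ sgE)) (fun t => ?_) x
  simp [T.deg, sgn_sub]

theorem sgE_singE {X Y : Ob} (x : E C B .tree X Y) : sgE (singE x) = singE (sgE x) := by
  refine lin_ext (f := sgE ∘ₗ singE) (g := singE ∘ₗ sgE) (fun t => ?_) x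
  simp [T.deg]

theorem sgE_nodeE {X Y Z : Ob} (x : E C B .tree X Y) (y : E C B .forest Y Z) :
    sgE (nodeE x y) = - nodeE (sgE x) (sgE y) := by
  induction x using bas_ind with
  | h0 => simp
  | hadd x x' hx hx' => simp only [map_add, LinearMap.add_apply, hx, hx']; abel
  | hsmul a x hx => simp only [map_smul, LinearMap.smul_apply, hx]; module
  | hb t =>
    refine lin_ext (f := sgE ∘ₗ nodeE (bas t)) (g := -(nodeE (sgE (bas t)) ∘ₗ sgE)) (fun F => ?_) y
    simp [T.deg, sgn_add, smul_smul, mul_comm]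

theorem sgE_consE {X Y Z : Ob} (x : E C B .tree X Y) (y : E C B .forest Y Z) :
    sgE (consE x y) = consE (sgE x) (sgE y) := by
  induction x using bas_ind with
  | h0 => simp
  | hadd x x' hx hx' => simp only [map_add, LinearMap.add_apply, hx, hx']
  | hsmul a x hx => simp only [map_smul, LinearMap.smul_apply, hx]
  | hb t =>
    refine lin_ext (f := sgE ∘ₗ consE (bas t)) (g := consE (sgE (bas t)) ∘ₗ sgE) (fun F => ?_) y
    simp [T.deg, sgn_add, smul_smul, mul_comm]

theorem Lsp_singE {κ' : Kind} {X Y W : Ob}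
    (c : ∀ Z, E C B .tree W Z →ₗ[k] E C B .forest Z Y →ₗ[k] E C B κ' W Y)
    (Φ : ∀ Z, E C B .forest X Z →ₗ[k] E C B .tree W Z) (x : E C B .tree X Y) :
    Lsp c Φ (singE x) = 0 := by
  refine lin_ext (f := Lsp c Φ ∘ₗ singE) (g := 0) (fun t => ?_) x
  simp [T.splitSum]

theorem Lsp_tree {κ' : Kind} {X Y W : Ob}
    (c : ∀ Z, E C B .tree W Z →ₗ[k] E C B .forest Z Y →ₗ[k] E C B κ' W Y)
    (Φ : ∀ Z, E C B .forest X Z →ₗ[k] E C B .tree W Z) (x : E C B .tree X Y) :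
    Lsp c Φ x = 0 := by
  refine lin_ext (f := Lsp c Φ) (g := 0) (fun t => ?_) x
  cases t <;> simp [T.splitSum]

theorem Lsp_consE {κ' : Kind} {X Y Z W : Ob}
    (c : ∀ V, E C B .tree W V →ₗ[k] E C B .forest V Z →ₗ[k] E C B κ' W Z)
    (Φ : ∀ V, E C B .forest X V →ₗ[k] E C B .tree W V)
    (x : E C B .tree X Y) (y : E C B .forest Y Z) :
    Lsp c Φ (consE x y) = c _ (Φ _ (singE x)) (sgE y) + Lsp c (fun V => Φ V ∘ₗ consE x) y := by
  induction x using bas_ind with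
  | h0 => simp [Lsp_zero_right]
  | hadd x x' hx hx' =>
    simp only [map_add, LinearMap.add_apply, hx, hx', LinearMap.comp_add, Lsp_add_right]; abel
  | hsmul a x hx =>
    simp only [map_smul, LinearMap.smul_apply, hx, LinearMap.comp_smul, Lsp_smul_right]; module
  | hb t =>
    refine lin_ext (f := Lsp c Φ ∘ₗ consE (bas t)) (g := c _ (Φ _ (singE (bas t))) ∘ₗ sgE +
      Lsp c (fun V => Φ V ∘ₗ consE (bas t))) (fun F => ?_) y
    simp [T.splitSum]

/-! ### The relations are stable under the differential -/

theorem Rel.neg {κ : Kind} {X Y : Ob} {x : E C B κ X Y} (h : Rel x) : Rel (-x) := by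
  simpa using Rel.smul (-1) x h
theorem Rel.sub {κ : Kind} {X Y : Ob} {x y : E C B κ X Y} (h : Rel x) (h' : Rel y) :
    Rel (x - y) := by
  rw [sub_eq_add_neg]; exact h.add _ _ h'.neg
theorem Rel.congr {κ : Kind} {X Y : Ob} {x y : E C B κ X Y} (h : Rel x) (e : y = x) : Rel y :=
  e ▸ h

theorem Rel.hh {X Y : Ob} (h h' : B X ∨ B Y) (x : E C B .tree X Y) :
    Rel (hmtE h (hmtE h' x)) := by
  induction x using bas_ind with
  | h0 => simpa using Rel.zero
  | hadd x y hx hy => simpa using hx.add _ _ hy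
  | hsmul c x hx => simpa using hx.smul c _
  | hb t => simpa using Rel.hmt_hmt h h' t

theorem Rel.mul_two' {X Y Z : Ob} (m n l : ℤ) (h : m + n = l) (f : C.Hom X Y m)
    (g : C.Hom Y Z n) :
    Rel (bas (T.node (B := B) (.leaf m f) (.sing (.leaf n g))) -
        sgn k n • bas (.leaf l (C.comp h f g))) := by
  subst h; exact .mul_two m n f g

theorem Rel.sg {κ : Kind} {X Y : Ob} {x : E C B κ X Y} (h : Rel x) : Rel (sgE x) := by
  induction h with
  | leaf_add n f g =>
    refine ((Rel.leaf_add n f g).smul (sgn k (n - 1)) _).congr ?_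
    simp [T.deg, smul_sub, smul_add]
  | leaf_smul n c f =>
    refine ((Rel.leaf_smul n c f).smul (sgn k (n - 1)) _).congr ?_
    simp only [map_sub, map_smul, sgE_bas, T.deg]; module
  | hmt_hmt h h' t => simpa using (Rel.hmt_hmt h h' t).smul _ _
  | mul_two m n f g =>
    refine ((Rel.mul_two m n f g).smul (sgn k (m + n - 1)) _).congr ?_
    simp only [map_sub, map_smul, sgE_bas, T.deg]
    rw [show m - 1 + (n - 1) + 1 = m + n - 1 by ring]; module
  | mul_many m n f g F hF => simpa using (Rel.mul_many m n f g F hF).smul _ _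
  | zero => simpa using Rel.zero
  | add x y _ _ hx hy => simpa using hx.add _ _ hy
  | smul c x _ hx => simpa using hx.smul c _
  | hmt h x _ hx => rw [sgE_hmtE]; exact (hx.hmt h _).neg
  | node_left x y _ hx => rw [sgE_nodeE]; exact (hx.node_left _ _).neg
  | node_right x y _ hy => rw [sgE_nodeE]; exact (hy.node_right _ _).neg
  | sing x _ hx => rw [sgE_singE]; exact hx.sing
  | cons_left x y _ hx => rw [sgE_consE]; exact hx.cons_left _ _
  | cons_right x y _ hy => rw [sgE_consE]; exact hy.cons_right _ _

theorem Rel.split_left {κ κ' : Kind} {X Y W : Ob}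
    (c : ∀ Z, E C B .tree W Z →ₗ[k] E C B .forest Z Y →ₗ[k] E C B κ' W Y)
    (hc : ∀ Z x y, Rel x → Rel (c Z x y))
    (Φ : ∀ Z, E C B .forest X Z →ₗ[k] E C B .tree W Z) (hΦ : ∀ Z x, Rel (Φ Z x))
    (y : E C B κ X Y) : Rel (Lsp c Φ y) := by
  induction y using bas_ind with
  | h0 => simpa using Rel.zero
  | hadd x y hx hy => simpa using hx.add _ _ hy
  | hsmul c x hx => simpa using hx.smul c _
  | hb t =>
    rw [Lsp_bas]
    exact split_mem (ideal C B κ' W Y) t _ (fun Z F F' => (hc _ _ _ (hΦ _ _)).smul _ _)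

theorem Rel.split_right {κ κ' : Kind} {X Y W : Ob} {y : E C B κ X Y} (h : Rel y)
    (c : ∀ Z, E C B .tree W Z →ₗ[k] E C B .forest Z Y →ₗ[k] E C B κ' W Y)
    (hc : ∀ Z x y, Rel x → Rel (c Z x y)) (hc' : ∀ Z x y, Rel y → Rel (c Z x y))
    (Φ : ∀ Z, E C B .forest X Z →ₗ[k] E C B .tree W Z) (hΦ : ∀ Z x, Rel x → Rel (Φ Z x)) :
    Rel (Lsp c Φ y) := by
  induction h with
  | leaf_add n f g => rw [Lsp_tree]; exact .zero
  | leaf_smul n a f => rw [Lsp_tree]; exact .zero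
  | hmt_hmt h h' t => rw [Lsp_tree]; exact .zero
  | mul_two m n f g => rw [Lsp_tree]; exact .zero
  | mul_many m n f g F hF => rw [Lsp_tree]; exact .zero
  | zero => simpa using Rel.zero
  | add x y _ _ hx hy => simpa using (hx c hc hc' Φ hΦ).add _ _ (hy c hc hc' Φ hΦ)
  | smul a x _ hx => simpa using (hx c hc hc' Φ hΦ).smul a _
  | hmt h x _ hx => rw [Lsp_tree]; exact .zero
  | node_left x y _ hx => rw [Lsp_tree]; exact .zero
  | node_right x y _ hy => rw [Lsp_tree]; exact .zero
  | sing x _ hx => rw [Lsp_singE]; exact .zero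
  | cons_left x y h hx =>
    rw [Lsp_consE]
    exact (hc _ _ _ (hΦ _ _ h.sing)).add _ _
      (Rel.split_left c hc (fun V => Φ V ∘ₗ consE x) (fun Z z => hΦ Z _ (h.cons_left x z)) _)
  | cons_right x y h hy =>
    rw [Lsp_consE]
    exact (hc' _ _ _ h.sg).add _ _
      (hy c hc hc' (fun V => Φ V ∘ₗ consE x) (fun Z z hz => hΦ Z _ (hz.cons_right x z)))

/-! Forests of leaves. -/

/-- Elements which modulo the relations are combinations of forests of leaves. -/
def AL (C : DGCat.{w, v, u} k Ob) (B : Ob → Prop) (κ : Kind) (X Y : Ob) :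
    Submodule k (E C B κ X Y) :=
  ideal C B κ X Y ⊔ Submodule.span k {x | ∃ t : T C B κ X Y, t.AllLeaves ∧ x = bas t}

theorem ideal_le_AL {κ : Kind} {X Y : Ob} {x : E C B κ X Y} (h : Rel x) : x ∈ AL C B κ X Y :=
  Submodule.mem_sup_left (show x ∈ ideal C B κ X Y from h)

theorem bas_mem_AL {κ : Kind} {X Y : Ob} {t : T C B κ X Y} (h : t.AllLeaves) :
    bas t ∈ AL C B κ X Y :=
  Submodule.mem_sup_right (Submodule.subset_span ⟨t, h, rfl⟩)

theorem lin_mem {M : Type*} [AddCommGroup M] [Module k M] {κ : Kind} {X Y : Ob}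
    (f : E C B κ X Y →ₗ[k] M) (N : Submodule k M) (h1 : ∀ x, Rel x → f x ∈ N)
    (h2 : ∀ t : T C B κ X Y, t.AllLeaves → f (bas t) ∈ N) {x : E C B κ X Y}
    (hx : x ∈ AL C B κ X Y) : f x ∈ N := by
  have : AL C B κ X Y ≤ N.comap f := by
    refine sup_le (fun x hx => h1 x hx) (Submodule.span_le.2 ?_)
    rintro _ ⟨t, ht, rfl⟩
    exact h2 t ht
  exact this hx

theorem bil_mem {M : Type*} [AddCommGroup M] [Module k M] {κ κ' : Kind} {X Y X' Y' : Ob}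
    (c : E C B κ X Y →ₗ[k] E C B κ' X' Y' →ₗ[k] M) (N : Submodule k M)
    (h1 : ∀ x y, Rel x → c x y ∈ N) (h2 : ∀ x y, Rel y → c x y ∈ N)
    (h3 : ∀ (t : T C B κ X Y) (t' : T C B κ' X' Y'), t.AllLeaves → t'.AllLeaves →
      c (bas t) (bas t') ∈ N)
    {x : E C B κ X Y} {y : E C B κ' X' Y'} (hx : x ∈ AL C B κ X Y) (hy : y ∈ AL C B κ' X' Y') :
    c x y ∈ N := by
  refine lin_mem (c.flip y) N (fun x hx => h1 _ _ hx) (fun t ht => ?_) hx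
  exact lin_mem (c (bas t)) N (fun y hy => h2 _ _ hy) (fun t' ht' => h3 _ _ ht ht') hy

theorem sing_AL {X Y : Ob} {x : E C B .tree X Y} (h : x ∈ AL C B .tree X Y) :
    singE x ∈ AL C B .forest X Y :=
  lin_mem singE _ (fun _ h => ideal_le_AL h.sing)
    (fun t ht => by rw [singE_bas]; exact bas_mem_AL ht) h

theorem cons_AL {X Y Z : Ob} {x : E C B .tree X Y} {y : E C B .forest Y Z}
    (h : x ∈ AL C B .tree X Y) (h' : y ∈ AL C B .forest Y Z) :
    consE x y ∈ AL C B .forest X Z :=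
  bil_mem consE _ (fun _ _ h => ideal_le_AL (h.cons_left _ _))
    (fun _ _ h => ideal_le_AL (h.cons_right _ _))
    (fun t t' ht ht' => by rw [consE_bas]; exact bas_mem_AL ⟨ht, ht'⟩) h h'

theorem node_bas_AL {X Y Z : Ob} (t : T C B .tree X Y) (F : T C B .forest Y Z)
    (ht : t.AllLeaves) (hF : F.AllLeaves) : bas (.node t F) ∈ AL C B .tree X Z := by
  cases t with
  | leaf m f =>
    cases F with
    | sing t' =>
      cases t' with
      | leaf n g =>
        have := (AL C B .tree X Z).add_mem (ideal_le_AL (Rel.mul_two (B := B) m n f g))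
          ((AL C B .tree X Z).smul_mem (sgn k n)
            (bas_mem_AL (t := .leaf (m + n) (C.comp rfl f g)) trivial))
        simpa using this
      | hmt => exact hF.elim
      | node => exact hF.elim
    | cons t' F =>
      cases t' with
      | leaf n g => exact ideal_le_AL (Rel.mul_many m n f g F hF.2)
      | hmt => exact hF.1.elim
      | node => exact hF.1.elim
  | hmt => exact ht.elim
  | node => exact ht.elim

theorem node_AL {X Y Z : Ob} {x : E C B .tree X Y} {y : E C B .forest Y Z}
    (h : x ∈ AL C B .tree X Y) (h' : y ∈ AL C B .forest Y Z) :
    nodeE x y ∈ AL C B .tree X Z :=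
  bil_mem nodeE _ (fun _ _ h => ideal_le_AL (h.node_left _ _))
    (fun _ _ h => ideal_le_AL (h.node_right _ _))
    (fun t t' ht ht' => by rw [nodeE_bas]; exact node_bas_AL _ _ ht ht') h h'

theorem node_cons_AL {X Y Z W : Ob} {x : E C B .tree X Y} {y : E C B .tree Y Z}
    {z : E C B .forest Z W} (h : x ∈ AL C B .tree X Y) (h' : y ∈ AL C B .tree Y Z)
    (h'' : z ∈ AL C B .forest Z W) : Rel (nodeE x (consE y z)) := by
  refine lin_mem (nodeE.flip (consE y z)) (ideal C B .tree X W) (fun x h => h.node_left _ _)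
    (fun t ht => ?_) h
  refine bil_mem (consE.compr₂ (nodeE (bas t))) (ideal C B .tree X W)
    (fun x y h => (h.cons_left _ _).node_right _ _)
    (fun x y h => (h.cons_right _ _).node_right _ _) (fun t' F ht' hF => ?_) h' h''
  simp only [LinearMap.compr₂_apply, consE_bas, nodeE_bas]
  cases t with
  | leaf m f =>
    cases t' with
    | leaf n g => exact .mul_many m n f g F hF
    | hmt => exact ht'.elim
    | node => exact ht'.elim
  | hmt => exact ht.elim
  | node => exact ht.elim

theorem dT_AL {κ : Kind} {X Y : Ob} (t : T C B κ X Y) (ht : t.AllLeaves) :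
    dT t ∈ AL C B κ X Y := by
  induction t with
  | leaf n f => exact bas_mem_AL (t := .leaf _ _) trivial
  | hmt => exact ht.elim
  | node => exact ht.elim
  | sing t h => exact sing_AL (h ht)
  | cons t F h h' =>
    refine add_mem (add_mem (add_mem (cons_AL (bas_mem_AL ht.1) (h' ht.2))
      (Submodule.smul_mem _ _ (cons_AL (h ht.1) (bas_mem_AL ht.2)))) ?_)
      (by rw [← singE_bas]; exact sing_AL (node_bas_AL _ _ ht.1 ht.2))
    refine split_mem_leaves _ F ht.2 _ (fun Z F' F'' h1 h2 => Submodule.smul_mem _ _ ?_)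
    rw [← consE_bas]
    exact cons_AL (node_bas_AL _ _ ht.1 h1) (bas_mem_AL h2)

theorem assoc_leaves {X Y Z W : Ob} (m n p : ℤ) (f : C.Hom X Y m) (g : C.Hom Y Z n)
    (h : C.Hom Z W p) :
    Rel (bas (T.node (B := B) (.leaf m f) (.sing (.node (.leaf n g) (.sing (.leaf p h))))) +
      sgn k (p - 1) •
        bas (T.node (B := B) (.node (.leaf m f) (.sing (.leaf n g))) (.sing (.leaf p h)))) := by
  have h1 := ((Rel.mul_two (B := B) n p g h).sing).node_right (bas (.leaf m f)) _
  have h2 := (Rel.mul_two (B := B) m n f g).node_left _ (bas (.sing (.leaf p h)))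
  have h3 := Rel.mul_two' (B := B) m (n + p) (m + n + p) (by ring) f (C.comp rfl g h)
  have h4 := Rel.mul_two' (B := B) (m + n) p (m + n + p) rfl (C.comp rfl f g) h
  rw [C.assoc rfl rfl rfl (by ring) f g h] at h4
  have h5 := (h1.add _ _ (h3.smul (sgn k p) _)).add _ _
    ((h2.add _ _ (h4.smul (sgn k n) _)).smul (sgn k (p - 1)) _)
  refine h5.congr ?_
  simp only [map_sub, map_smul, LinearMap.sub_apply, LinearMap.smul_apply, singE_bas, nodeE_bas]
  simp only [sgn_add, sgn_sub, sgn_one]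
  generalize bas (C := C) (B := B) (T.leaf (m + n + p) _) = z
  have e := sgn_mul_self (k := k) p
  match_scalars
  · ring
  · ring
  · ring
  · ring
  · ring

theorem Rel.d_mul_two {X Y Z : Ob} (m n : ℤ) (f : C.Hom X Y m) (g : C.Hom Y Z n) :
    Rel (dE (bas (T.node (B := B) (.leaf m f) (.sing (.leaf n g))) -
        sgn k n • bas (.leaf (m + n) (C.comp rfl f g)))) := by
  have h1 := Rel.mul_two' (B := B) m (n + 1) (m + n + 1) (by ring) f (C.d n _ rfl g)
  have h2 := Rel.mul_two' (B := B) (m + 1) n (m + n + 1) (by ring) (C.d m _ rfl f) g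
  have h3 := Rel.leaf_add (B := B) (m + n + 1)
    (C.comp (by ring) f (C.d n _ rfl g))
    (sgn k n • (C.comp (by ring) (C.d m _ rfl f) g : C.Hom X Z (m + n + 1)))
  have h4 := Rel.leaf_smul (B := B) (m + n + 1) (sgn k n)
    (C.comp (by ring) (C.d m _ rfl f) g)
  have h5 := ((h1.add _ _ (h2.smul (sgn k (n - 1)) _)).neg).sub
    ((h3.add _ _ h4).smul (sgn k n) _)
  refine h5.congr ?_
  simp only [map_sub, map_smul, dE_bas, dT, T.deg, T.splitSum, singE_bas, nodeE_bas]
  rw [C.leibniz rfl rfl rfl rfl (by ring) (by ring) f g, negOnePow_smul (k := k)]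
  simp only [sgn_add, sgn_sub, sgn_one]
  have e := sgn_mul_self (k := k) n
  match_scalars <;> first | ring1 | linear_combination e | linear_combination -e

theorem Rel.d_mul_many {X Y Z W : Ob} (m n : ℤ) (f : C.Hom X Y m) (g : C.Hom Y Z n)
    (F : T C B .forest Z W) (hF : F.AllLeaves) :
    Rel (dE (bas (.node (.leaf m f) (.cons (.leaf n g) F)))) := by
  have hf : bas (.leaf m f) ∈ AL C B .tree X Y := bas_mem_AL (t := .leaf m f) trivial
  have hg : bas (.leaf n g) ∈ AL C B .tree Y Z := bas_mem_AL (t := .leaf n g) trivial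
  have hdf : bas (.leaf _ (C.d m _ rfl f)) ∈ AL C B .tree X Y :=
    bas_mem_AL (t := .leaf _ _) trivial
  have hdg : bas (.leaf _ (C.d n _ rfl g)) ∈ AL C B .tree Y Z :=
    bas_mem_AL (t := .leaf _ _) trivial
  have hFA := bas_mem_AL hF
  have e1 := node_cons_AL hf hg (dT_AL F hF)
  have e2 := (node_cons_AL hf hdg hFA).smul (sgn k F.deg) _
  have e3 : Rel (nodeE (bas (.leaf m f)) (T.splitSum F (fun _ F' F'' =>
      sgn k F''.deg • bas (.cons (.node (.leaf n g) F') F'')))) := by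
    rw [split_map]
    refine split_mem_leaves (ideal C B .tree X W) F hF _ (fun V F' F'' h1 h2 => ?_)
    rw [map_smul, ← consE_bas]
    exact (node_cons_AL hf (node_bas_AL (.leaf n g) F' trivial h1) (bas_mem_AL h2)).smul _ _
  have e4 := (node_cons_AL hdf hg hFA).smul (sgn k (n - 1 + F.deg)) _
  have e5 : Rel (T.splitSum F (fun _ F' F'' =>
      sgn k F''.deg • bas (.node (.node (.leaf m f) (.cons (.leaf n g) F')) F''))) := by
    refine split_mem_leaves (ideal C B .tree X W) F hF _ (fun V F' F'' h1 h2 => ?_)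
    rw [← nodeE_bas]
    exact ((Rel.mul_many m n f g F' h1).node_left _ _).smul _ _
  have e6 : Rel (bas (T.node (.leaf m f) (.sing (.node (.leaf n g) F))) + sgn k F.deg •
      bas (T.node (.node (.leaf m f) (.sing (.leaf n g))) F)) := by
    cases F with
    | sing t =>
      cases t with
      | leaf p h => exact assoc_leaves m n p f g h
      | hmt => exact hF.elim
      | node => exact hF.elim
    | cons t F =>
      refine Rel.add _ _ ?_ (Rel.smul _ _ ?_)
      · rw [← nodeE_bas, ← singE_bas]
        refine Rel.node_right _ _ (Rel.sing _ ?_)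
        rw [← nodeE_bas, ← consE_bas]
        exact node_cons_AL hg (bas_mem_AL hF.1) (bas_mem_AL hF.2)
      · rw [← nodeE_bas, ← consE_bas]
        exact node_cons_AL (node_bas_AL (.leaf m f) (.sing (.leaf n g)) trivial trivial) (bas_mem_AL hF.1) (bas_mem_AL hF.2)
  refine (((((e1.add _ _ e2).add _ _ e3).add _ _ e4).add _ _ e5).add _ _ e6).neg.congr ?_
  simp only [dE_bas, dT, T.splitSum, T.deg, map_add, map_smul, consE_bas, nodeE_bas, singE_bas]
  abel

theorem Rel.dd {κ : Kind} {X Y : Ob} {x : E C B κ X Y} (h : Rel x) : Rel (dE x) := by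
  induction h with
  | leaf_add n f g =>
    simp only [map_sub, map_add, dE_bas, dT]; exact .leaf_add _ _ _
  | leaf_smul n c f =>
    simp only [map_sub, map_smul, dE_bas, dT]; exact .leaf_smul _ _ _
  | hmt_hmt h h' t =>
    refine (Rel.hh h h' (dT t)).congr ?_
    simp [dT]
  | mul_two m n f g => exact .d_mul_two m n f g
  | mul_many m n f g F hF => exact .d_mul_many m n f g F hF
  | zero => simpa using Rel.zero
  | add x y _ _ hx hy => simpa using hx.add _ _ hy
  | smul c x _ hx => simpa using hx.smul c _
  | hmt h x h' hx => rw [dE_hmtE]; exact h'.sub (hx.hmt h _)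
  | node_left x y h hx =>
    rw [dE_nodeE]
    exact (((h.node_left _ _).add _ _ (hx.node_left _ _)).add _ _
      (Rel.split_left _ (fun _ _ _ h => h.node_left _ _) (fun _ => nodeE x)
        (fun _ _ => h.node_left _ _) _)).neg
  | node_right x y h hy =>
    rw [dE_nodeE]
    exact (((hy.node_right _ _).add _ _ (h.sg.node_right _ _)).add _ _
      (h.split_right _ (fun _ _ _ h => h.node_left _ _) (fun _ _ _ h => h.node_right _ _)
        (fun _ => nodeE x) (fun _ _ h => h.node_right _ _))).neg
  | sing x _ hx => rw [dE_singE]; exact hx.sing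
  | cons_left x y h hx =>
    rw [dE_consE]
    exact (((h.cons_left _ _).add _ _ (hx.cons_left _ _)).add _ _
      (Rel.split_left _ (fun _ _ _ h => h.cons_left _ _) (fun _ => nodeE x)
        (fun _ _ => h.node_left _ _) _)).add _ _ (h.node_left _ _).sing
  | cons_right x y h hy =>
    rw [dE_consE]
    exact (((hy.cons_right _ _).add _ _ (h.sg.cons_right _ _)).add _ _
      (h.split_right _ (fun _ _ _ h => h.cons_left _ _) (fun _ _ _ h => h.cons_right _ _)
        (fun _ => nodeE x) (fun _ _ h => h.node_right _ _))).add _ _ (h.node_right _ _).sing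

/-! ### Composition with the unit on the left is homotopic to the identity -/

/-- The unit, as a tree. -/
abbrev uT (C : DGCat.{w, v, u} k Ob) (B : Ob → Prop) (X : Ob) : T C B .tree X X :=
  .leaf 0 (C.one X)

theorem rel_leaf_zero {X Y : Ob} (n : ℤ) : Rel (bas (T.leaf (C := C) (B := B) (X := X) (Y := Y) n 0)) := by
  simpa using Rel.leaf_smul (B := B) n 0 (0 : C.Hom X Y n)

theorem rel_dT_u (X : Ob) : Rel (dT (uT C B X)) := by
  have h := rel_leaf_zero (C := C) (B := B) (X := X) (Y := X) (0 + 1)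
  rw [← C.d_one X] at h
  exact h

/-- Multiplication by the unit on the left. -/
def lmul {X Y : Ob} : E C B .tree X Y →ₗ[k] E C B .tree X Y :=
  nodeE (bas (uT C B X)) ∘ₗ singE ∘ₗ sgE

theorem Rel.lm {X Y : Ob} {x : E C B .tree X Y} (h : Rel x) : Rel (lmul x) :=
  (h.sg.sing).node_right _ _

theorem sgE_dT {κ : Kind} {X Y : Ob} (t : T C B κ X Y) :
    sgE (dT t) = - sgn k t.deg • dT t := by
  induction t with
  | leaf n f => simp [dT, T.deg, sgn_sub, sgn_add]
  | hmt h t ih =>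
    simp only [dT, map_sub, sgE_bas, sgE_hmtE, ih, T.deg, sgn_sub, sgn_one, map_smul]
    module
  | node t F ht hF =>
    simp only [dT, map_neg, map_add, sgE_nodeE, ht, hF, map_smul, sgE_bas, LinearMap.smul_apply,
      split_map]
    rw [split_congr (M := E C B _ _ _) F _ (fun Z F' F'' => (sgn k t.deg * sgn k F.deg) •
      (sgn k F''.deg • bas (.node (.node t F') F''))) (fun Z F' F'' h => ?_), split_smul]
    · simp only [T.deg, sgn_add, sgn_one]; module
    · simp only [T.deg, sgn_add, sgn_one, ← h]; module
  | sing t ht => simp [dT, sgE_singE, ht, T.deg]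
  | cons t F ht hF =>
    simp only [dT, map_add, sgE_consE, ht, hF, map_smul, sgE_bas, LinearMap.smul_apply,
      split_map]
    rw [split_congr (M := E C B _ _ _) F _ (fun Z F' F'' => -(sgn k t.deg * sgn k F.deg) •
      (sgn k F''.deg • bas (.cons (.node t F') F''))) (fun Z F' F'' h => ?_), split_smul]
    · simp only [T.deg, sgn_add, sgn_one]; module
    · simp only [T.deg, sgn_add, sgn_one, ← h]; module

theorem sgE_dE {κ : Kind} {X Y : Ob} (x : E C B κ X Y) : sgE (dE x) = - dE (sgE x) := by
  refine lin_ext (f := sgE ∘ₗ dE) (g := -(dE ∘ₗ sgE)) (fun t => ?_) x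
  simp [sgE_dT]

theorem dE_lmul {X Y : Ob} (x : E C B .tree X Y) : Rel (dE (lmul x) - lmul (dE x)) := by
  refine ((rel_dT_u (C := C) (B := B) X).node_left _ (sgE (singE (sgE x)))).neg.congr ?_
  simp only [lmul, LinearMap.comp_apply, dE_nodeE, Lsp_singE, dE_singE, sgE_dE, map_neg, dE_bas]
  abel

/-- The homotopy between the identity and multiplication by the unit on the left. -/
def lh : ∀ {κ : Kind} {X Y : Ob}, T C B κ X Y → E C B κ X Y
  | _, _, _, .leaf _ _ => 0
  | _, _, _, .hmt h t => hmtE h (lmul (hmtE h (bas t))) - hmtE h (lh t)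
  | _, X, _, .node t F => (sgn k t.deg * sgn k F.deg) • bas (.node (uT C B X) (.cons t F)) -
      sgn k F.deg • nodeE (lh t) (bas F)
  | _, _, _, .sing _ => 0
  | _, _, _, .cons _ _ => 0

/-- The linear extension of `lh`. -/
def lhE {κ : Kind} {X Y : Ob} : E C B κ X Y →ₗ[k] E C B κ X Y := lin lh

@[simp] theorem lhE_bas {κ : Kind} {X Y : Ob} (t : T C B κ X Y) : lhE (bas t) = lh t := by
  simp [lhE]

theorem lhE_hmtE {X Y : Ob} (h : B X ∨ B Y) (x : E C B .tree X Y) :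
    lhE (hmtE h x) = hmtE h (lmul (hmtE h x)) - hmtE h (lhE x) := by
  refine lin_ext (f := lhE ∘ₗ hmtE h) (g := hmtE h ∘ₗ lmul ∘ₗ hmtE h - hmtE h ∘ₗ lhE)
    (fun t => ?_) x
  simp [lh]

theorem lhE_nodeE {X Y Z : Ob} (x : E C B .tree X Y) (y : E C B .forest Y Z) :
    lhE (nodeE x y) =
      nodeE (bas (uT C B X)) (consE (sgE x) (sgE y)) - nodeE (lhE x) (sgE y) := by
  induction x using bas_ind with
  | h0 => simp
  | hadd x x' hx hx' => simp only [map_add, LinearMap.add_apply, hx, hx']; abel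
  | hsmul a x hx => simp only [map_smul, LinearMap.smul_apply, hx]; module
  | hb t =>
    refine lin_ext (f := lhE ∘ₗ nodeE (bas t)) (g := nodeE (bas (uT C B X)) ∘ₗ
      consE (sgE (bas t)) ∘ₗ sgE - nodeE (lhE (bas t)) ∘ₗ sgE) (fun F => ?_) y
    simp [lh, mul_smul]

theorem lhE_singE {X Y : Ob} (x : E C B .tree X Y) : lhE (singE x) = 0 := by
  refine lin_ext (f := lhE ∘ₗ singE) (g := 0) (fun t => ?_) x
  simp [lh]

theorem lhE_consE {X Y Z : Ob} (x : E C B .tree X Y) (y : E C B .forest Y Z) :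
    lhE (consE x y) = 0 := by
  induction x using bas_ind with
  | h0 => simp
  | hadd x x' hx hx' => simp only [map_add, LinearMap.add_apply, hx, hx']; abel
  | hsmul a x hx => simp only [map_smul, LinearMap.smul_apply, hx]; module
  | hb t =>
    refine lin_ext (f := lhE ∘ₗ consE (bas t)) (g := 0) (fun F => ?_) y
    simp [lh]

theorem Rel.lhh {κ : Kind} {X Y : Ob} {x : E C B κ X Y} (h : Rel x) : Rel (lhE x) := by
  induction h with
  | leaf_add n f g => refine Rel.zero.congr ?_; simp [lh]
  | leaf_smul n c f => refine Rel.zero.congr ?_; simp [lh]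
  | hmt_hmt h h' t =>
    rw [← hmtE_bas, ← hmtE_bas, lhE_hmtE, lhE_hmtE, map_sub]
    exact ((Rel.hh h h' _).lm.hmt _ _).sub ((Rel.hh _ _ _).sub (Rel.hh _ _ _))
  | mul_two m n f g =>
    refine ((Rel.mul_many 0 m (C.one _) f (.sing (.leaf n g))
      (by simp [T.AllLeaves])).smul
      (sgn k (m - 1) * sgn k (n - 1)) _).congr ?_
    simp [lh, T.deg]
  | mul_many m n f g F hF =>
    refine ((Rel.mul_many 0 m (C.one _) f (.cons (.leaf n g) F) ⟨trivial, hF⟩).smul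
      (sgn k (m - 1) * sgn k (n - 1 + F.deg)) _).congr ?_
    simp [lh, T.deg]
  | zero => simpa using Rel.zero
  | add x y _ _ hx hy => simpa using hx.add _ _ hy
  | smul c x _ hx => simpa using hx.smul c _
  | hmt h x h' hx => rw [lhE_hmtE]; exact ((h'.hmt h _).lm.hmt _ _).sub (hx.hmt _ _)
  | node_left x y h hx =>
    rw [lhE_nodeE]
    exact ((h.sg.cons_left _ _).node_right _ _).sub (hx.node_left _ _)
  | node_right x y h hy =>
    rw [lhE_nodeE]
    exact ((h.sg.cons_right _ _).node_right _ _).sub (h.sg.node_right _ _)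
  | sing x _ hx => rw [lhE_singE]; exact .zero
  | cons_left x y h hx => rw [lhE_consE]; exact .zero
  | cons_right x y h hy => rw [lhE_consE]; exact .zero

theorem lh_leaf {X Y : Ob} (n : ℤ) (f : C.Hom X Y n) :
    Rel (bas (T.leaf (B := B) n f) + lmul (bas (.leaf n f))) := by
  have h := (Rel.mul_two' (B := B) 0 n n (zero_add n) (C.one X) f).smul (sgn k (n - 1)) _
  rw [C.one_comp] at h
  refine h.congr ?_
  simp only [lmul, LinearMap.comp_apply, sgE_bas, T.deg, map_smul, singE_bas, nodeE_bas,
    sgn_sub, sgn_one]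
  have e := sgn_mul_self (k := k) n
  match_scalars <;> first | ring1 | linear_combination e | linear_combination -e

theorem lh_split {X Y Z : Ob} (t : T C B .tree X Y) (F : T C B .forest Y Z) :
    lhE (F.splitSum (fun _ F' F'' => sgn k F''.deg • bas (.node (.node t F') F''))) =
      -(sgn k t.deg * sgn k F.deg) • nodeE (bas (uT C B X))
        (F.splitSum (fun _ F' F'' => sgn k F''.deg • bas (.cons (.node t F') F''))) +
      (-(sgn k t.deg * sgn k F.deg)) •
        F.splitSum (fun _ F' F'' => sgn k F''.deg •
          bas (T.node (.node (uT C B X) (.cons t F')) F'')) +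
      sgn k F.deg • F.splitSum (fun _ F' F'' => sgn k F''.deg •
        nodeE (nodeE (lh t) (bas F')) (bas F'')) := by
  simp only [split_map, ← split_smul, ← split_add]
  refine split_congr (M := E C B _ _ _) F _ _ (fun V F' F'' h => ?_)
  simp only [← h, map_smul, lhE_bas, lh, map_add, map_sub, T.deg, sgn_add, sgn_one,
    LinearMap.smul_apply, LinearMap.sub_apply, nodeE_bas]
  module

theorem lh_spec : ∀ {X Y : Ob} (t : T C B .tree X Y),
    Rel (dE (lh t) + lhE (dT t) - (bas t + lmul (bas t)))
  | _, _, .leaf n f => by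
    refine (lh_leaf (B := B) n f).neg.congr ?_
    simp [lh, dT]
  | _, _, .hmt h t => by
    have h1 := (dE_lmul (hmtE h (bas t))).hmt h _
    have h2 := (lh_spec t).hmt h _
    refine (h2.sub h1).congr ?_
    simp only [lh, dT, map_sub, map_add, dE_hmtE, lhE_hmtE, lhE_bas, hmtE_bas, dE_bas]
    abel
  | X, _, .node t F => by
    have h1 := (lh_spec t).node_left _ (bas F)
    have h2 := ((rel_dT_u (C := C) (B := B) X).node_left _ (bas (.cons t F)))
    refine (h1.sub h2).congr ?_
    simp only [lh, map_sub, map_smul, dE_bas, dT, map_neg, map_add, lh_split, T.splitSum,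
      dE_nodeE, Lsp_bas, lhE_nodeE, lmul, LinearMap.comp_apply, sgE_bas, sgE_dT, singE_bas,
      nodeE_bas, consE_bas, LinearMap.smul_apply, LinearMap.sub_apply, LinearMap.add_apply,
      LinearMap.neg_apply, T.deg, sgn_add, sgn_one, lhE_bas, smul_neg, smul_add, smul_sub, smul_smul]
    have e := sgn_mul_self (k := k) F.deg
    have e' := sgn_mul_self (k := k) t.deg
    match_scalars <;> first | ring1 | linear_combination e | linear_combination -e | linear_combination (sgn k t.deg) * e | linear_combination (-sgn k t.deg) * e | linear_combination e * sgn k t.deg * sgn k t.deg + e' | linear_combination -e * sgn k t.deg * sgn k t.deg - e'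

/-! ### Composition with the unit on the right is homotopic to the identity -/

/-- Append the unit of the target object to a tree or forest. -/
def app : ∀ {κ : Kind} {X Y : Ob}, T C B κ X Y → T C B .forest X Y
  | _, _, Y, .leaf n f => .cons (.leaf n f) (.sing (uT C B Y))
  | _, _, Y, .hmt h t => .cons (.hmt h t) (.sing (uT C B Y))
  | _, _, Y, .node t F => .cons (.node t F) (.sing (uT C B Y))
  | _, _, Y, .sing t => .cons t (.sing (uT C B Y))
  | _, _, _, .cons t F => .cons t (app F)

theorem app_tree {X Y : Ob} (t : T C B .tree X Y) : app t = .cons t (.sing (uT C B Y)) := by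
  cases t <;> rfl

theorem deg_app {κ : Kind} {X Y : Ob} (t : T C B κ X Y) : (app t).deg = t.deg - 1 := by
  induction t with
  | leaf => simp [app, T.deg]; ring
  | hmt => simp [app, T.deg]; ring
  | node => simp [app, T.deg]
  | sing => simp [app, T.deg]; ring
  | cons t F ht hF => simp only [app, T.deg, hF]; ring

theorem AllLeaves_app {κ : Kind} {X Y : Ob} (t : T C B κ X Y) (h : t.AllLeaves) :
    (app t).AllLeaves := by
  induction t with
  | leaf => simp [app, T.AllLeaves]
  | hmt => exact h.elim
  | node => exact h.elim
  | sing t => exact ⟨h, by simp [T.AllLeaves]⟩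
  | cons t F ht hF => exact ⟨h.1, hF h.2⟩

theorem split_app {M : Type*} [AddCommGroup M] : ∀ {X Y : Ob} (F : T C B .forest X Y)
    (φ : ∀ Z : Ob, T C B .forest X Z → T C B .forest Z Y → M),
    (app F).splitSum φ =
      F.splitSum (fun Z F' F'' => φ Z F' (app F'')) + φ Y F (.sing (uT C B Y))
  | _, _, .sing t, φ => by simp [app, T.splitSum]
  | _, _, .cons t F, φ => by
    simp only [app, T.splitSum]
    rw [split_app F]
    abel

/-- The linear extension of `app`. -/
def appE {κ : Kind} {X Y : Ob} : E C B κ X Y →ₗ[k] E C B .forest X Y := lin (fun t => bas (app t))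

@[simp] theorem appE_bas {κ : Kind} {X Y : Ob} (t : T C B κ X Y) : appE (bas t) = bas (app t) := by
  simp [appE]

theorem appE_tree {X Y : Ob} (x : E C B .tree X Y) :
    appE x = consE x (bas (.sing (uT C B Y))) := by
  refine lin_ext (f := appE) (g := consE.flip (bas (.sing (uT C B Y)))) (fun t => ?_) x
  simp [app_tree]

theorem appE_singE {X Y : Ob} (x : E C B .tree X Y) :
    appE (singE x) = consE x (bas (.sing (uT C B Y))) := by
  refine lin_ext (f := appE ∘ₗ singE) (g := consE.flip (bas (.sing (uT C B Y)))) (fun t => ?_) x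
  simp [app]

theorem appE_consE {X Y Z : Ob} (x : E C B .tree X Y) (y : E C B .forest Y Z) :
    appE (consE x y) = consE x (appE y) := by
  induction x using bas_ind with
  | h0 => simp
  | hadd x x' hx hx' => simp only [map_add, LinearMap.add_apply, hx, hx']
  | hsmul a x hx => simp only [map_smul, LinearMap.smul_apply, hx]
  | hb t =>
    refine lin_ext (f := appE ∘ₗ consE (bas t)) (g := consE (bas t) ∘ₗ appE) (fun F => ?_) y
    simp [app]

theorem Rel.ap {κ : Kind} {X Y : Ob} {x : E C B κ X Y} (h : Rel x) : Rel (appE x) := by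
  induction h with
  | leaf_add n f g => rw [appE_tree]; exact (Rel.leaf_add _ _ _).cons_left _ _
  | leaf_smul n c f => rw [appE_tree]; exact (Rel.leaf_smul _ _ _).cons_left _ _
  | hmt_hmt h h' t => rw [appE_tree]; exact (Rel.hmt_hmt _ _ _).cons_left _ _
  | mul_two m n f g => rw [appE_tree]; exact (Rel.mul_two _ _ _ _).cons_left _ _
  | mul_many m n f g F hF => rw [appE_tree]; exact (Rel.mul_many _ _ _ _ _ hF).cons_left _ _
  | zero => simpa using Rel.zero
  | add x y _ _ hx hy => simpa using hx.add _ _ hy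
  | smul c x _ hx => simpa using hx.smul c _
  | hmt h x h' hx => rw [appE_tree]; exact (h'.hmt _ _).cons_left _ _
  | node_left x y h hx => rw [appE_tree]; exact (h.node_left _ _).cons_left _ _
  | node_right x y h hy => rw [appE_tree]; exact (h.node_right _ _).cons_left _ _
  | sing x h hx => rw [appE_singE]; exact h.cons_left _ _
  | cons_left x y h hx => rw [appE_consE]; exact h.cons_left _ _
  | cons_right x y h hy => rw [appE_consE]; exact hy.cons_right _ _

/-- Multiplication by the unit on the right. -/
def rmul {X Y : Ob} : E C B .tree X Y →ₗ[k] E C B .tree X Y :=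
  nodeE.flip (bas (.sing (uT C B Y)))

theorem Rel.rm {X Y : Ob} {x : E C B .tree X Y} (h : Rel x) : Rel (rmul x) := h.node_left _ _

theorem dE_rmul {X Y : Ob} (x : E C B .tree X Y) : Rel (dE (rmul x) - rmul (dE x)) := by
  refine ((rel_dT_u (C := C) (B := B) Y).sing.node_right x _).neg.congr ?_
  simp only [rmul, LinearMap.flip_apply, dE_nodeE, dE_bas, dT, Lsp_bas, T.splitSum, sgE_bas, T.deg,
    map_smul]
  norm_num

/-- The sum over all nonempty suffixes `G` of a forest, with `G` replaced by the product of `G`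
and the unit. -/
def wt : ∀ {κ : Kind} {X Y : Ob}, T C B κ X Y → E C B κ X Y
  | _, _, _, .leaf n f => rmul (bas (.leaf n f))
  | _, _, _, .hmt h t => rmul (bas (.hmt h t))
  | _, _, _, .node t F => rmul (bas (.node t F))
  | _, _, _, .sing t => singE (rmul (bas t))
  | _, _, _, .cons t F => consE (bas t) (wt F) + bas (.sing (.node t (app F)))

theorem wt_tree {X Y : Ob} (t : T C B .tree X Y) : wt t = rmul (bas t) := by
  cases t <;> rfl

theorem dT_app : ∀ {X Y : Ob} (F : T C B .forest X Y), Rel (dT (app F) + appE (dT F) - wt F)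
  | _, Y, .sing t => by
    refine ((rel_dT_u (C := C) (B := B) Y).sing.cons_right (bas t) _).congr ?_
    simp only [app, dT, wt, T.splitSum, appE_singE, rmul, LinearMap.flip_apply, nodeE_bas,
      singE_bas, T.deg]
    norm_num
    abel
  | _, Y, .cons t F => by
    refine ((dT_app F).cons_right (bas t) _).congr ?_
    simp only [app, dT, wt, split_app, deg_app, map_add, map_sub, appE_consE, map_smul, appE_bas,
      split_map, appE_tree, singE_bas, appE_singE]
    rw [split_congr (M := E C B _ _ _) F
      (fun Z F' F'' => sgn k (F''.deg - 1) • bas (.cons (.node t F') (app F'')))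
      (fun Z F' F'' => (-1 : k) • (sgn k F''.deg • bas (.cons (.node t F') (app F''))))
      (fun Z F' F'' h => by rw [sgn_sub, sgn_one]; module), split_smul]
    simp only [T.deg, sgn_sub, sgn_one, sgn_zero]
    module

/-- The homotopy between the identity and multiplication by the unit on the right. -/
def rh : ∀ {κ : Kind} {X Y : Ob}, T C B κ X Y → E C B κ X Y
  | _, _, _, .leaf _ _ => 0
  | _, _, _, .hmt h t => - hmtE h (rmul (hmtE h (bas t))) - hmtE h (rh t)
  | _, _, _, .node t F => - bas (.node t (app F)) - nodeE (bas t) (rh F)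
  | _, _, _, .sing t => singE (rh t)
  | _, _, _, .cons t F => consE (bas t) (rh F)

/-- The linear extension of `rh`. -/
def rhE {κ : Kind} {X Y : Ob} : E C B κ X Y →ₗ[k] E C B κ X Y := lin rh

@[simp] theorem rhE_bas {κ : Kind} {X Y : Ob} (t : T C B κ X Y) : rhE (bas t) = rh t := by
  simp [rhE]

theorem rhE_hmtE {X Y : Ob} (h : B X ∨ B Y) (x : E C B .tree X Y) :
    rhE (hmtE h x) = - hmtE h (rmul (hmtE h x)) - hmtE h (rhE x) := by
  refine lin_ext (f := rhE ∘ₗ hmtE h) (g := -(hmtE h ∘ₗ rmul ∘ₗ hmtE h) - hmtE h ∘ₗ rhE)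
    (fun t => ?_) x
  simp [rh]

theorem rhE_nodeE {X Y Z : Ob} (x : E C B .tree X Y) (y : E C B .forest Y Z) :
    rhE (nodeE x y) = - nodeE x (appE y) - nodeE x (rhE y) := by
  induction x using bas_ind with
  | h0 => simp
  | hadd x x' hx hx' => simp only [map_add, LinearMap.add_apply, hx, hx']; abel
  | hsmul a x hx => simp only [map_smul, LinearMap.smul_apply, hx]; module
  | hb t =>
    refine lin_ext (f := rhE ∘ₗ nodeE (bas t)) (g := -(nodeE (bas t) ∘ₗ appE) -
      nodeE (bas t) ∘ₗ rhE) (fun F => ?_) y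
    simp [rh]

theorem rhE_singE {X Y : Ob} (x : E C B .tree X Y) : rhE (singE x) = singE (rhE x) := by
  refine lin_ext (f := rhE ∘ₗ singE) (g := singE ∘ₗ rhE) (fun t => ?_) x
  simp [rh]

theorem rhE_consE {X Y Z : Ob} (x : E C B .tree X Y) (y : E C B .forest Y Z) :
    rhE (consE x y) = consE x (rhE y) := by
  induction x using bas_ind with
  | h0 => simp
  | hadd x x' hx hx' => simp only [map_add, LinearMap.add_apply, hx, hx']
  | hsmul a x hx => simp only [map_smul, LinearMap.smul_apply, hx]
  | hb t =>
    refine lin_ext (f := rhE ∘ₗ consE (bas t)) (g := consE (bas t) ∘ₗ rhE) (fun F => ?_) y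
    simp [rh]

theorem rh_leaves {κ : Kind} {X Y : Ob} (t : T C B κ X Y) (h : t.AllLeaves) : rh t = 0 := by
  induction t with
  | leaf => rfl
  | hmt => exact h.elim
  | node => exact h.elim
  | sing t ht => simp [rh, ht h]
  | cons t F ht hF => simp [rh, hF h.2]

theorem Rel.rhh {κ : Kind} {X Y : Ob} {x : E C B κ X Y} (h : Rel x) : Rel (rhE x) := by
  induction h with
  | leaf_add n f g => refine Rel.zero.congr ?_; simp [rh]
  | leaf_smul n c f => refine Rel.zero.congr ?_; simp [rh]
  | hmt_hmt h h' t =>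
    rw [← hmtE_bas, ← hmtE_bas, rhE_hmtE, rhE_hmtE, map_sub, map_neg]
    exact ((Rel.hh h h' _).rm.hmt _ _).neg.sub ((Rel.hh _ _ _).neg.sub (Rel.hh _ _ _))
  | @mul_two X Y Z m n f g =>
    refine ((Rel.mul_many m n f g (.sing (uT C B Z)) (by simp [T.AllLeaves])).neg).congr ?_
    simp [rh, app]
  | mul_many m n f g F hF =>
    refine ((Rel.mul_many m n f g (app F) (AllLeaves_app F hF)).neg).congr ?_
    simp [rh, app, rh_leaves F hF]
  | zero => simpa using Rel.zero
  | add x y _ _ hx hy => simpa using hx.add _ _ hy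
  | smul c x _ hx => simpa using hx.smul c _
  | hmt h x h' hx => rw [rhE_hmtE]; exact ((h'.hmt h _).rm.hmt _ _).neg.sub (hx.hmt _ _)
  | node_left x y h hx =>
    rw [rhE_nodeE]
    exact (h.node_left _ _).neg.sub (h.node_left _ _)
  | node_right x y h hy =>
    rw [rhE_nodeE]
    exact (h.ap.node_right _ _).neg.sub (hy.node_right _ _)
  | sing x _ hx => rw [rhE_singE]; exact hx.sing
  | cons_left x y h hx => rw [rhE_consE]; exact h.cons_left _ _
  | cons_right x y h hy => rw [rhE_consE]; exact hy.cons_right _ _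

theorem sgE_rmul {X Y : Ob} (x : E C B .tree X Y) : sgE (rmul x) = rmul (sgE x) := by
  simp [rmul, sgE_nodeE, T.deg]

theorem sgE_rh {κ : Kind} {X Y : Ob} (t : T C B κ X Y) : sgE (rh t) = - sgn k t.deg • rh t := by
  induction t with
  | leaf => simp [rh]
  | hmt h t ih =>
    simp only [rh, map_sub, map_neg, sgE_hmtE, sgE_rmul, sgE_bas, ih, map_smul, T.deg, sgn_sub,
      sgn_one]
    module
  | node t F ht hF =>
    simp only [rh, map_sub, map_neg, sgE_nodeE, sgE_bas, hF, map_smul, T.deg, sgn_add, deg_app,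
      sgn_sub, sgn_one, LinearMap.smul_apply]
    module
  | sing t ht => simp [rh, sgE_singE, ht, T.deg]
  | cons t F ht hF =>
    simp only [rh, sgE_consE, sgE_bas, hF, map_smul, T.deg, sgn_add, LinearMap.smul_apply]
    module

theorem Lsp_rh : ∀ {κ' : Kind} {X Y W : Ob} (F : T C B .forest X Y)
    (c : ∀ Z, E C B .tree W Z →ₗ[k] E C B .forest Z Y →ₗ[k] E C B κ' W Y)
    (Φ : ∀ Z, E C B .forest X Z →ₗ[k] E C B .tree W Z),
    Lsp c Φ (rh F) =
      - F.splitSum (fun Z F' F'' => sgn k F''.deg • c Z (Φ Z (bas F')) (rh F''))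
  | _, _, _, _, .sing t, c, Φ => by simp [rh, Lsp_singE, T.splitSum]
  | _, _, _, _, .cons t F, c, Φ => by
    simp only [rh, Lsp_consE, T.splitSum, Lsp_rh F, sgE_rh, singE_bas, LinearMap.comp_apply,
      consE_bas, map_smul]
    module

theorem rh_split {X Y Z : Ob} (t : T C B .tree X Y) (F : T C B .forest Y Z) :
    rhE (F.splitSum (fun _ F' F'' => sgn k F''.deg • bas (.node (.node t F') F''))) =
      (-1 : k) • F.splitSum (fun _ F' F'' => sgn k F''.deg • bas (.node (.node t F') (app F''))) +
      (-1 : k) • F.splitSum (fun _ F' F'' =>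
        sgn k F''.deg • nodeE (bas (.node t F')) (rh F'')) := by
  simp only [split_map, ← split_smul, ← split_add]
  refine split_congr (M := E C B _ _ _) F _ _ (fun V F' F'' h => ?_)
  simp only [map_smul, rhE_bas, rh]
  module

theorem app_split {X Y Z : Ob} (t : T C B .tree X Y) (F : T C B .forest Y Z) :
    F.splitSum (fun _ F' F'' => (sgn k F''.deg * -1) • bas (.node (.node t F') (app F''))) =
      (-1 : k) • F.splitSum (fun _ F' F'' =>
        sgn k F''.deg • bas (.node (.node t F') (app F''))) := by
  rw [← split_smul]
  refine split_congr (M := E C B _ _ _) F _ _ (fun V F' F'' h => ?_)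
  module

theorem rh_spec {κ : Kind} {X Y : Ob} (t : T C B κ X Y) :
    Rel (dE (rh t) + rhE (dT t) - (bas t - wt t)) := by
  induction t with
  | @leaf X Y n f =>
    have h := Rel.mul_two' (B := B) n 0 n (add_zero n) f (C.one Y)
    rw [C.comp_one] at h
    refine h.congr ?_
    simp [rh, dT, wt, rmul]
  | hmt h t ih =>
    rw [wt_tree] at ih ⊢
    have h1 := (dE_rmul (hmtE h (bas t))).hmt h _
    have h2 := ih.hmt h _
    refine (h1.add _ _ h2).congr ?_
    simp only [rh, dT, map_sub, map_add, map_neg, dE_hmtE, rhE_hmtE, rhE_bas, hmtE_bas, dE_bas]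
    abel
  | node t F ht hF =>
    have h1 := (dT_app F).node_right (bas t) _
    have h2 := hF.node_right (bas t) _
    refine (h1.add _ _ h2).congr ?_
    simp only [rh, map_sub, map_neg, dE_bas, dT, map_add, dE_nodeE, sgE_rh, Lsp_rh, rhE_nodeE,
      split_app, deg_app, rh_split, app_split, map_smul, wt, rmul, LinearMap.flip_apply, nodeE_bas,
      appE_bas, smul_sub, smul_neg, rhE_bas, T.deg, sgn_sub, sgn_one, sgn_zero]
    module
  | sing t ht =>
    rw [wt_tree] at ht
    refine ht.sing.congr ?_
    simp [rh, dT, wt, dE_singE, rhE_singE]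
  | cons t F ht hF =>
    have h2 := hF.cons_right (bas t) _
    refine h2.congr ?_
    simp only [rh, map_sub, map_neg, dE_bas, dT, map_add, dE_consE, sgE_rh, Lsp_rh, rhE_consE,
      split_map, map_smul, rhE_bas, wt, nodeE_bas,
      appE_bas, smul_add, smul_sub, smul_neg, LinearMap.sub_apply, LinearMap.neg_apply, rhE_singE, consE_bas, singE_bas]
    module

/-! ### The quotient `D = Q(C|B)` -/
section quotient

variable (C B)

/-- The quiver `sD = sE / (R_C)₊` of the quotient `D = Q(C|B)`. -/
def sD (X Y : Ob) := E C B .tree X Y ⧸ ideal C B .tree X Y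

instance instAddCommGroupSD (X Y : Ob) : AddCommGroup (sD C B X Y) :=
  inferInstanceAs (AddCommGroup (E C B .tree X Y ⧸ ideal C B .tree X Y))

instance instModuleSD (X Y : Ob) : Module k (sD C B X Y) :=
  inferInstanceAs (Module k (E C B .tree X Y ⧸ ideal C B .tree X Y))

/-- The class in `sD` of an element of the module of trees. -/
def toD (X Y : Ob) : E C B .tree X Y →ₗ[k] sD C B X Y := (ideal C B .tree X Y).mkQ

variable {C B}

theorem toD_surj {X Y : Ob} (a : sD C B X Y) : ∃ x, toD C B X Y x = a :=
  Submodule.mkQ_surjective _ a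

theorem toD_eq_zero {X Y : Ob} (x : E C B .tree X Y) : toD C B X Y x = 0 ↔ Rel x :=
  Submodule.Quotient.mk_eq_zero _

theorem toD_eq {X Y : Ob} (x y : E C B .tree X Y) :
    toD C B X Y x = toD C B X Y y ↔ Rel (x - y) := by
  rw [← toD_eq_zero, map_sub, sub_eq_zero]

variable (C B)

/-- The component of degree `n` of the graded module spanned by the tree monomials. -/
def gr (κ : Kind) (X Y : Ob) (n : ℤ) : Submodule k (E C B κ X Y) :=
  Submodule.span k {x | ∃ t : T C B κ X Y, t.deg = n ∧ x = bas t}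

/-- The component of degree `n` of `sD(X, Y)`. -/
def grD (X Y : Ob) (n : ℤ) : Submodule k (sD C B X Y) := (gr C B .tree X Y n).map (toD C B X Y)

/-- The differential `b₁` of `D`. -/
def b₁ (X Y : Ob) : sD C B X Y →ₗ[k] sD C B X Y :=
  (ideal C B .tree X Y).mapQ (ideal C B .tree X Y) dE (fun _ h => Rel.dd h)

/-- The binary operation `b₂` of `D`. -/
def b₂ (X Y Z : Ob) : sD C B X Y →ₗ[k] sD C B Y Z →ₗ[k] sD C B X Z :=
  (ideal C B .tree X Y).liftQ
    { toFun := fun x => (ideal C B .tree Y Z).mapQ (ideal C B .tree X Z) (nodeE x ∘ₗ singE)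
        (fun _ h => Rel.node_right _ _ (Rel.sing _ h))
      map_add' := fun x y => by
        refine LinearMap.ext fun z => ?_
        obtain ⟨z, rfl⟩ := Submodule.mkQ_surjective _ z
        simp
        rfl
      map_smul' := fun c x => by
        refine LinearMap.ext fun z => ?_
        obtain ⟨z, rfl⟩ := Submodule.mkQ_surjective _ z
        simp
        rfl }
    (fun x h => by
      refine LinearMap.ext fun z => ?_
      obtain ⟨z, rfl⟩ := toD_surj z
      exact (toD_eq_zero _).2 (Rel.node_left x _ h))

variable {C B}

@[simp] theorem b₁_toD {X Y : Ob} (x : E C B .tree X Y) :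
    b₁ C B X Y (toD C B X Y x) = toD C B X Y (dE x) := rfl

@[simp] theorem b₂_toD {X Y Z : Ob} (x : E C B .tree X Y) (y : E C B .tree Y Z) :
    b₂ C B X Y Z (toD C B X Y x) (toD C B Y Z y) = toD C B X Z (nodeE x (singE y)) := rfl


theorem bas_gr {κ : Kind} {X Y : Ob} (t : T C B κ X Y) : bas t ∈ gr C B κ X Y t.deg :=
  Submodule.subset_span ⟨t, rfl, rfl⟩

theorem gr_lin {κ : Kind} {X Y : Ob} {M : Type*} [AddCommGroup M] [Module k M] {n : ℤ}
    (f : E C B κ X Y →ₗ[k] M) (N : Submodule k M)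
    (h : ∀ t : T C B κ X Y, t.deg = n → f (bas t) ∈ N) {x : E C B κ X Y}
    (hx : x ∈ gr C B κ X Y n) : f x ∈ N := by
  have : gr C B κ X Y n ≤ N.comap f := by
    refine Submodule.span_le.2 ?_
    rintro _ ⟨t, ht, rfl⟩
    exact h t ht
  exact this hx

theorem gr_congr {κ : Kind} {X Y : Ob} {m n : ℤ} {x : E C B κ X Y} (hx : x ∈ gr C B κ X Y m)
    (h : m = n) : x ∈ gr C B κ X Y n := h ▸ hx

theorem gr_hmt {X Y : Ob} (h : B X ∨ B Y) {n : ℤ} {x : E C B .tree X Y}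
    (hx : x ∈ gr C B .tree X Y n) : hmtE h x ∈ gr C B .tree X Y (n - 1) :=
  gr_lin (hmtE h) _ (fun t ht => by
    rw [hmtE_bas]; exact gr_congr (bas_gr _) (by simp [T.deg, ht])) hx

theorem gr_sing {X Y : Ob} {n : ℤ} {x : E C B .tree X Y}
    (hx : x ∈ gr C B .tree X Y n) : singE x ∈ gr C B .forest X Y n :=
  gr_lin singE _ (fun t ht => by
    rw [singE_bas]; exact gr_congr (bas_gr _) (by simp [T.deg, ht])) hx

theorem gr_node {X Y Z : Ob} {m n : ℤ} {x : E C B .tree X Y} {y : E C B .forest Y Z}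
    (hx : x ∈ gr C B .tree X Y m) (hy : y ∈ gr C B .forest Y Z n) :
    nodeE x y ∈ gr C B .tree X Z (m + n + 1) :=
  gr_lin (nodeE.flip y) _ (fun t ht => gr_lin (nodeE (bas t)) _ (fun F hF => by
    rw [nodeE_bas]; exact gr_congr (bas_gr _) (by simp [T.deg, ht, hF])) hy) hx

theorem gr_cons {X Y Z : Ob} {m n : ℤ} {x : E C B .tree X Y} {y : E C B .forest Y Z}
    (hx : x ∈ gr C B .tree X Y m) (hy : y ∈ gr C B .forest Y Z n) :
    consE x y ∈ gr C B .forest X Z (m + n) :=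
  gr_lin (consE.flip y) _ (fun t ht => gr_lin (consE (bas t)) _ (fun F hF => by
    rw [consE_bas]; exact gr_congr (bas_gr _) (by simp [T.deg, ht, hF])) hy) hx

theorem gr_sg {κ : Kind} {X Y : Ob} {n : ℤ} {x : E C B κ X Y} (hx : x ∈ gr C B κ X Y n) :
    sgE x = sgn k n • x := by
  have := gr_lin (sgE - sgn k n • LinearMap.id) ⊥ (fun t ht => by simp [ht]) hx
  simpa [sub_eq_zero] using this

theorem gr_lmul {X Y : Ob} {n : ℤ} {x : E C B .tree X Y} (hx : x ∈ gr C B .tree X Y n) :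
    lmul x ∈ gr C B .tree X Y n := by
  simp only [lmul, LinearMap.comp_apply, gr_sg hx, map_smul]
  exact Submodule.smul_mem _ _ (gr_congr (gr_node (bas_gr _) (gr_sing hx)) (by simp [T.deg]))

theorem gr_rmul {X Y : Ob} {n : ℤ} {x : E C B .tree X Y} (hx : x ∈ gr C B .tree X Y n) :
    rmul x ∈ gr C B .tree X Y n :=
  gr_congr (gr_node hx (bas_gr _)) (by simp [T.deg])

theorem gr_lh : ∀ {X Y : Ob} (t : T C B .tree X Y), lh t ∈ gr C B .tree X Y (t.deg - 1)
  | _, _, .leaf n f => Submodule.zero_mem _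
  | _, _, .hmt h t => by
    refine Submodule.sub_mem _ (gr_hmt h (gr_lmul ?_)) (gr_hmt h (gr_lh t))
    exact gr_hmt h (bas_gr t)
  | _, _, .node t F => by
    refine Submodule.sub_mem _ (Submodule.smul_mem _ _ ?_) (Submodule.smul_mem _ _ ?_)
    · exact gr_congr (bas_gr _) (by simp [T.deg])
    · exact gr_congr (gr_node (gr_lh t) (bas_gr F)) (by simp [T.deg]; ring)

theorem gr_rh {κ : Kind} {X Y : Ob} (t : T C B κ X Y) : rh t ∈ gr C B κ X Y (t.deg - 1) := by
  induction t with
  | leaf n f => exact Submodule.zero_mem _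
  | hmt h t ih =>
    refine Submodule.sub_mem _ (Submodule.neg_mem _ (gr_hmt h (gr_rmul ?_))) (gr_hmt h ih)
    exact gr_hmt h (bas_gr t)
  | node t F ht hF =>
    refine Submodule.sub_mem _ (Submodule.neg_mem _ ?_) ?_
    · exact gr_congr (bas_gr _) (by simp only [T.deg, deg_app]; ring)
    · exact gr_congr (gr_node (bas_gr t) hF) (by simp only [T.deg]; ring)
  | sing t ht => exact gr_sing ht
  | cons t F ht hF => exact gr_congr (gr_cons (bas_gr t) hF) (by simp [T.deg]; ring)

theorem gr_lhE {X Y : Ob} {n : ℤ} {x : E C B .tree X Y} (hx : x ∈ gr C B .tree X Y n) :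
    lhE x ∈ gr C B .tree X Y (n - 1) :=
  gr_lin lhE _ (fun t ht => by rw [lhE_bas, ← ht]; exact gr_lh t) hx

theorem gr_rhE {X Y : Ob} {n : ℤ} {x : E C B .tree X Y} (hx : x ∈ gr C B .tree X Y n) :
    rhE x ∈ gr C B .tree X Y (n - 1) :=
  gr_lin rhE _ (fun t ht => by rw [rhE_bas, ← ht]; exact gr_rh t) hx

theorem lhE_spec {X Y : Ob} (x : E C B .tree X Y) :
    Rel (dE (lhE x) + lhE (dE x) - (x + lmul x)) := by
  induction x using bas_ind with
  | h0 => simpa using Rel.zero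
  | hadd x y hx hy => refine (hx.add _ _ hy).congr ?_; simp only [map_add]; abel
  | hsmul c x hx => refine (hx.smul c _).congr ?_; simp only [map_smul]; module
  | hb t => rw [lhE_bas, dE_bas]; exact lh_spec t

theorem rhE_spec {X Y : Ob} (x : E C B .tree X Y) :
    Rel (dE (rhE x) + rhE (dE x) - (x - rmul x)) := by
  induction x using bas_ind with
  | h0 => simpa using Rel.zero
  | hadd x y hx hy => refine (hx.add _ _ hy).congr ?_; simp only [map_add]; abel
  | hsmul c x hx => refine (hx.smul c _).congr ?_; simp only [map_smul]; module
  | hb t => rw [rhE_bas, dE_bas, ← wt_tree]; exact rh_spec t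

theorem b₂_gr {X Y Z : Ob} {m n l : ℤ} (h : m + n + 1 = l) {a : sD C B X Y} {b : sD C B Y Z}
    (ha : a ∈ grD C B X Y m) (hb : b ∈ grD C B Y Z n) : b₂ C B X Y Z a b ∈ grD C B X Z l := by
  obtain ⟨x, hx, rfl⟩ := ha
  obtain ⟨y, hy, rfl⟩ := hb
  subst h
  exact ⟨_, gr_node hx (gr_sing hy), rfl⟩

theorem b₁_b₂ {X Y Z : Ob} {n : ℤ} (a : sD C B X Y) {b : sD C B Y Z} (hb : b ∈ grD C B Y Z n) :
    b₁ C B X Z (b₂ C B X Y Z a b) =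
      -(b₂ C B X Y Z a (b₁ C B Y Z b) + sgn k n • b₂ C B X Y Z (b₁ C B X Y a) b) := by
  obtain ⟨x, rfl⟩ := toD_surj a
  obtain ⟨y, hy, rfl⟩ := hb
  simp only [b₂_toD, b₁_toD, ← map_smul, ← map_add, ← map_neg]
  congr 1
  rw [dE_nodeE, Lsp_singE, sgE_singE, gr_sg hy, dE_singE, add_zero, map_smul, map_smul]

theorem b₂_assoc {X Y Z W : Ob} {a : sD C B X Y} {b : sD C B Y Z} {c : sD C B Z W}
    (ha : a ∈ grD C B X Y (-1)) (hb : b ∈ grD C B Y Z (-1)) (hc : c ∈ grD C B Z W (-1))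
    (da : b₁ C B X Y a = 0) (db : b₁ C B Y Z b = 0) (dc : b₁ C B Z W c = 0) :
    ∃ e ∈ grD C B X W (-2), b₁ C B X W e =
      b₂ C B X Z W (b₂ C B X Y Z a b) c - b₂ C B X Y W a (b₂ C B Y Z W b c) := by
  obtain ⟨x, hx, rfl⟩ := ha
  obtain ⟨y, hy, rfl⟩ := hb
  obtain ⟨z, hz, rfl⟩ := hc
  simp only [b₁_toD, toD_eq_zero] at da db dc
  refine ⟨toD C B X W (nodeE x (consE y (singE z))),
    ⟨_, gr_congr (gr_node hx (gr_cons hy (gr_sing hz))) (by norm_num), rfl⟩, ?_⟩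
  simp only [b₂_toD, b₁_toD, ← map_sub]
  rw [toD_eq]
  have h1 := ((dc.sing.cons_right y _).node_right x _).neg
  have h2 := ((db.cons_left _ (singE z)).node_right x _)
  have h3 := da.node_left _ (consE y (singE z))
  refine ((h1.add _ _ h2).sub h3).congr ?_
  simp only [dE_nodeE, dE_consE, Lsp_consE, Lsp_singE, sgE_consE, sgE_singE, gr_sg hz, gr_sg hy,
    dE_singE, map_smul, map_add, LinearMap.smul_apply, sgn_neg_one, map_zero]
  module

/-! ### The category `H⁰(D)` -/

variable (C B)

/-- Cycles of degree `0` of `D(X, Y)`, that is, of degree `-1` of `sD(X, Y)`. -/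
def Z0 (X Y : Ob) : Submodule k (sD C B X Y) := grD C B X Y (-1) ⊓ LinearMap.ker (b₁ C B X Y)

/-- Boundaries of degree `0` of `D(X, Y)`. -/
def B0 (X Y : Ob) : Submodule k (sD C B X Y) := (grD C B X Y (-2)).map (b₁ C B X Y)

/-- `H⁰(D(X, Y), m₁)`. -/
def H0Hom (X Y : Ob) := Z0 C B X Y ⧸ (B0 C B X Y).submoduleOf (Z0 C B X Y)

instance instAddCommGroupH0Hom (X Y : Ob) : AddCommGroup (H0Hom C B X Y) :=
  inferInstanceAs (AddCommGroup (Z0 C B X Y ⧸ (B0 C B X Y).submoduleOf (Z0 C B X Y)))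

instance instModuleH0Hom (X Y : Ob) : Module k (H0Hom C B X Y) :=
  inferInstanceAs (Module k (Z0 C B X Y ⧸ (B0 C B X Y).submoduleOf (Z0 C B X Y)))

/-- The class of a cycle. -/
def H0mk {X Y : Ob} : Z0 C B X Y →ₗ[k] H0Hom C B X Y :=
  ((B0 C B X Y).submoduleOf (Z0 C B X Y)).mkQ

variable {C B}

theorem H0mk_eq {X Y : Ob} (a b : Z0 C B X Y) :
    H0mk C B a = H0mk C B b ↔ (a : sD C B X Y) - b ∈ B0 C B X Y := by
  rw [← sub_eq_zero, ← map_sub]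
  exact Submodule.Quotient.mk_eq_zero _

theorem b₂_Z0 {X Y Z : Ob} (a : Z0 C B X Y) (b : Z0 C B Y Z) :
    b₂ C B X Y Z a b ∈ Z0 C B X Z := by
  obtain ⟨a, ha, da⟩ := a
  obtain ⟨b, hb, db⟩ := b
  have da : b₁ C B X Y a = 0 := da
  have db : b₁ C B Y Z b = 0 := db
  refine ⟨b₂_gr (by norm_num) ha hb, ?_⟩
  change b₁ C B X Z (b₂ C B X Y Z a b) = 0
  rw [b₁_b₂ a hb, da, db]
  simp

/-- Composition of degree `0` cycles; in degree `0` one has `m₂ = b₂` under the identification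
`D(X, Y)⁰ = sD(X, Y)⁻¹`. -/
def mulZ {X Y Z : Ob} : Z0 C B X Y →ₗ[k] Z0 C B Y Z →ₗ[k] Z0 C B X Z :=
  LinearMap.mk₂ k (fun a b => ⟨b₂ C B X Y Z a b, b₂_Z0 a b⟩)
    (fun _ _ _ => Subtype.ext (by simp)) (fun _ _ _ => Subtype.ext (by simp))
    (fun _ _ _ => Subtype.ext (by simp)) (fun _ _ _ => Subtype.ext (by simp))

@[simp] theorem mulZ_coe {X Y Z : Ob} (a : Z0 C B X Y) (b : Z0 C B Y Z) :
    (mulZ a b : sD C B X Z) = b₂ C B X Y Z a b := rfl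

theorem b₂_B0_left {X Y Z : Ob} {a : sD C B X Y} (ha : a ∈ B0 C B X Y) (b : Z0 C B Y Z) :
    b₂ C B X Y Z a b ∈ B0 C B X Z := by
  obtain ⟨c, hc, rfl⟩ := ha
  obtain ⟨b, hb, db⟩ := b
  have db : b₁ C B Y Z b = 0 := db
  refine ⟨b₂ C B X Y Z c b, b₂_gr (by norm_num) hc hb, ?_⟩
  rw [b₁_b₂ c hb, db]
  simp

theorem b₂_B0_right {X Y Z : Ob} (a : Z0 C B X Y) {b : sD C B Y Z} (hb : b ∈ B0 C B Y Z) :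
    b₂ C B X Y Z a b ∈ B0 C B X Z := by
  obtain ⟨c, hc, rfl⟩ := hb
  obtain ⟨a, ha, da⟩ := a
  have da : b₁ C B X Y a = 0 := da
  refine ⟨-b₂ C B X Y Z a c, Submodule.neg_mem _ (b₂_gr (by norm_num) ha hc), ?_⟩
  rw [map_neg, b₁_b₂ a hc, da]
  simp

/-- Composition in `H⁰(D)`, induced by `m₂`. -/
def H0comp {X Y Z : Ob} : H0Hom C B X Y →ₗ[k] H0Hom C B Y Z →ₗ[k] H0Hom C B X Z :=
  Submodule.liftQ _
    { toFun := fun a => Submodule.mapQ _ _ (mulZ a) (fun _ hb => b₂_B0_right a hb)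
      map_add' := fun a b => by
        refine LinearMap.ext fun z => ?_
        obtain ⟨z, rfl⟩ := Submodule.mkQ_surjective _ z
        simp
        rfl
      map_smul' := fun c a => by
        refine LinearMap.ext fun z => ?_
        obtain ⟨z, rfl⟩ := Submodule.mkQ_surjective _ z
        simp
        rfl }
    (fun a ha => by
      refine LinearMap.ext fun z => ?_
      obtain ⟨z, rfl⟩ := Submodule.mkQ_surjective _ z
      exact (Submodule.Quotient.mk_eq_zero _).2 (b₂_B0_left ha z))

theorem H0comp_mk {X Y Z : Ob} (a : Z0 C B X Y) (b : Z0 C B Y Z) :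
    H0comp (H0mk C B a) (H0mk C B b) = H0mk C B (mulZ a b) := rfl

theorem H0mk_surj {X Y : Ob} (a : H0Hom C B X Y) : ∃ x, H0mk C B x = a :=
  Submodule.mkQ_surjective _ a

/-- A closed morphism of degree `0` of `C`, as a cycle of `D`. -/
def eZ {X Y : Ob} (f : C.Hom X Y 0) (hf : C.d 0 1 (zero_add 1) f = 0) : Z0 C B X Y :=
  ⟨toD C B X Y (bas (.leaf 0 f)), ⟨_, gr_congr (bas_gr _) (by simp [T.deg]), rfl⟩, by
    change b₁ C B X Y (toD C B X Y _) = 0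
    rw [b₁_toD, dE_bas, toD_eq_zero]
    have h := rel_leaf_zero (C := C) (B := B) (X := X) (Y := Y) (0 + 1)
    rw [← hf] at h
    exact h⟩

theorem eZ_comp {X Y Z : Ob} (f : C.Hom X Y 0) (hf : C.d 0 1 (zero_add 1) f = 0)
    (g : C.Hom Y Z 0) (hg : C.d 0 1 (zero_add 1) g = 0)
    (hfg : C.d 0 1 (zero_add 1) (C.comp (zero_add 0) f g) = 0) :
    eZ (B := B) (C.comp (zero_add 0) f g) hfg = mulZ (eZ f hf) (eZ g hg) := by
  refine Subtype.ext ?_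
  change toD C B X Z (bas _) = toD C B X Z (nodeE (bas _) (singE (bas _)))
  rw [toD_eq]
  refine (Rel.mul_two' (B := B) 0 0 0 (zero_add 0) f g).neg.congr ?_
  rw [sgn_zero, one_smul, singE_bas, nodeE_bas, neg_sub]

theorem dT_leaf {X Y : Ob} (n m : ℤ) (h : n + 1 = m) (f : C.Hom X Y n) :
    dT (T.leaf (B := B) n f) = bas (.leaf m (C.d n m h f)) := by
  subst h; rfl

theorem eZ_homotopy {X Y : Ob} (z : C.Hom X Y (-1)) (f g : C.Hom X Y 0)
    (hf : C.d 0 1 (zero_add 1) f = 0) (hg : C.d 0 1 (zero_add 1) g = 0)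
    (h : f = C.d (-1) 0 (neg_add_cancel 1) z + g) :
    H0mk C B (eZ f hf) = H0mk C B (eZ g hg) := by
  refine (H0mk_eq _ _).2 ⟨toD C B X Y (bas (.leaf (-1) z)),
    ⟨_, gr_congr (bas_gr _) (by norm_num [T.deg]), rfl⟩, ?_⟩
  change b₁ C B X Y (toD C B X Y _) = toD C B X Y (bas _) - toD C B X Y (bas _)
  rw [b₁_toD, dE_bas, ← map_sub, toD_eq]
  subst h
  have h' := Rel.leaf_add (B := B) 0 (C.d (-1) 0 (neg_add_cancel 1) z) g
  refine h'.neg.congr ?_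
  rw [dT_leaf (-1) 0 (neg_add_cancel 1) z]
  abel

variable (C B)

/-- The homotopy category `H⁰(D)` of `D = Q(C|B)`: it has the same objects as `C`, the morphisms are
`H⁰(D(X, Y), m₁)`, the composition is induced by `m₂`, and the identities are the classes of the
identities of `C`. -/
structure H0 (C : DGCat.{w, v, u} k Ob) (B : Ob → Prop) where
  of ::
  as : Ob

variable {C B}

instance instCategoryH0 : Category (H0 C B) where
  Hom X Y := H0Hom C B X.as Y.as
  id X := H0mk C B (eZ (C.one X.as) (C.d_one X.as))
  comp f g := H0comp f g
  id_comp {X Y} f := by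
    obtain ⟨⟨a, ⟨x, hx, rfl⟩, da⟩, rfl⟩ := H0mk_surj f
    have da : Rel (dE x) := (toD_eq_zero _).1 da
    refine (H0mk_eq _ _).2 ⟨-toD C B _ _ (lhE x),
      Submodule.neg_mem _ ⟨_, gr_congr (gr_lhE hx) (by norm_num), rfl⟩, ?_⟩
    change b₁ C B _ _ (-toD C B _ _ (lhE x)) = toD C B _ _ (nodeE (bas (uT C B _)) (singE x)) - toD C B _ _ x
    rw [map_neg, b₁_toD, ← map_neg, ← map_sub, toD_eq]
    refine ((lhE_spec x).neg.add _ _ da.lhh).congr ?_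
    simp only [lmul, LinearMap.comp_apply, gr_sg hx, sgn_neg_one, map_smul]
    module
  comp_id {X Y} f := by
    obtain ⟨⟨a, ⟨x, hx, rfl⟩, da⟩, rfl⟩ := H0mk_surj f
    have da : Rel (dE x) := (toD_eq_zero _).1 da
    refine (H0mk_eq _ _).2 ⟨-toD C B _ _ (rhE x),
      Submodule.neg_mem _ ⟨_, gr_congr (gr_rhE hx) (by norm_num), rfl⟩, ?_⟩
    change b₁ C B _ _ (-toD C B _ _ (rhE x)) = toD C B _ _ (nodeE x (singE (bas (uT C B _)))) - toD C B _ _ x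
    rw [map_neg, b₁_toD, ← map_neg, ← map_sub, toD_eq]
    refine ((rhE_spec x).neg.add _ _ da.rhh).congr ?_
    simp only [rmul, LinearMap.flip_apply, singE_bas]
    module
  assoc {X Y Z W} f g h := by
    obtain ⟨⟨a, ha, da⟩, rfl⟩ := H0mk_surj f
    obtain ⟨⟨b, hb, db⟩, rfl⟩ := H0mk_surj g
    obtain ⟨⟨c, hc, dc⟩, rfl⟩ := H0mk_surj h
    obtain ⟨e, he, h⟩ := b₂_assoc ha hb hc da db dc
    exact (H0mk_eq _ _).2 ⟨e, he, h⟩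

end quotient
end lemmas
end

section complexes

variable (k : Type w) [CommRing k] (A : Type u) [Category.{v} A] [Abelian A] [Linear k A]

open CochainComplex.HomComplex

/-- The functor `H⁰e : H⁰C → H⁰D` induced by the embedding `e : C → Q(C|B)`, where `C` is the
differential graded category of complexes in `A`, `B` is the class of acyclic complexes, and `H⁰C` is
the homotopy category of complexes.  It is the identity on objects, and it sends the homotopy class of
`f` to the cohomology class of the trivial tree labelled by `f`. -/
def H0e : HomotopyCategory A (ComplexShape.up ℤ) ⥤
    H0 (complexes k A) (fun K => K.Acyclic) :=
  CategoryTheory.Quotient.lift _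
    { obj := fun K => ⟨K⟩
      map := fun {K L} f => H0mk _ _ (eZ (C := complexes k A) (X := K) (Y := L)
        (Cochain.ofHom f) (δ_ofHom f))
      map_id := fun K => rfl
      map_comp := fun {K L M} f g => by
        have h := eZ_comp (C := complexes k A) (B := fun K => K.Acyclic) (X := K) (Y := L) (Z := M)
          (Cochain.ofHom f) (δ_ofHom f) (Cochain.ofHom g) (δ_ofHom g)
        change H0mk _ _ _ = H0mk _ _ (mulZ _ _)
        rw [← h]
        · congr 1
          refine Subtype.ext ?_
          change toD _ _ _ _ (bas (.leaf 0 _)) = toD _ _ _ _ (bas (.leaf 0 _))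
          rw [Cochain.ofHom_comp]
          rfl
        · change δ 0 1 ((Cochain.ofHom f).comp (Cochain.ofHom g) (zero_add 0)) = 0
          rw [← Cochain.ofHom_comp]
          exact δ_ofHom _ }
    (by
      rintro K L f g ⟨h⟩
      obtain ⟨z, hz⟩ := Cochain.equivHomotopy f g h
      exact eZ_homotopy (C := complexes k A) (B := fun K => K.Acyclic) (X := K) (Y := L) z
        (Cochain.ofHom f) (Cochain.ofHom g) (δ_ofHom f) (δ_ofHom g) hz)

end complexes

/-- The Verdier quotient `H⁰C / H⁰B` of the homotopy category of complexes by its full subcategory of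
acyclic complexes: the localization at the class of morphisms whose cone is acyclic.  It has the same
objects as the homotopy category. -/
abbrev VerdierQuotient (A : Type u) [Category.{v} A] [Abelian A] :=
  (HomotopyCategory.subcategoryAcyclic A).trW.Localization

/-- The quotient functor `Q_Verdier : H⁰C → H⁰C / H⁰B`, which is the identity on objects. -/
abbrev verdierQ (A : Type u) [Category.{v} A] [Abelian A] :
    HomotopyCategory A (ComplexShape.up ℤ) ⥤ VerdierQuotient A :=
  (HomotopyCategory.subcategoryAcyclic A).trW.Q

end DGCat

end

/-!
The point is that an object `K` of `B` is contractible in `D`: the element `h = H(1_K)` of degree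
`-1` of `D(K, K)` satisfies `h b₁ = 1_K`, as `H b₁ = 1 - b₁ H` and `1_K` is closed.

Let `q : X → Y` be a quasi-isomorphism and `K` its cone, with the structure maps `i : X → K`
(degree `-1`), `j : Y → K` (degree `0`), `f : K → X` (degree `1`) and `s : K → Y` (degree `0`).
Then `j` and `f` are closed, `j f = 0`, `i f = 1_X`, `j s = 1_Y`, `d i = q j` and `d s = -f q`.
Since `K` is acyclic, `h` exists.  If `D` were a differential graded category, `j h f` would be a
cycle of degree `0` from `Y` to `X`, and a homotopy inverse of `q`: in the order of the arrows,
`j h f q - j s = -d (j h s)` and `q j h f - i f = d (i h f)`.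

In `D` the product `b₂` is associative only up to the homotopy `b₃`, so the two bracketings of
`j h f` are distinct cycles.  It is convenient to use `((j ⊗ h) b₂ ⊗ f) b₂` for one composite
(`exists_leftInverse_H0mk_eZ`) and `-(j ⊗ (h ⊗ f) b₂) b₂` for the other
(`exists_rightInverse_H0mk_eZ`): then the terms `b₃` that reassociate the products have boundaries
that contain, apart from the two bracketings, only `b₃` applied to three morphisms of `C`, which is
zero in `D`.  Thus the class of `q` is split epi and split mono, hence invertible.

The morphisms of the homotopy category with acyclic cone are the quasi-isomorphisms.  Therefore
`H⁰e` factors through the localization, strictly and as the identity on objects, by the universal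
property of the constructed localization, and the Verdier quotient is equivalent to the derived
category, both being localizations at the same class of morphisms.
-/

namespace DGCat

section

variable {k : Type w} [CommRing k] {Ob : Type u} {C : DGCat.{w, v, u} k Ob} {B : Ob → Prop}

/-! ### Differentials of small trees -/

theorem rel_dT_leaf {X Y : Ob} {n m : ℤ} (h : n + 1 = m) {f : C.Hom X Y n}
    (hf : C.d n m h f = 0) : Rel (dT (T.leaf (B := B) n f)) := by
  rw [dT_leaf n m h, hf]
  exact rel_leaf_zero m

/-- Two cycles of degree `0` of `D` have the same class if, modulo the relations, the difference of
representatives in `E` is the differential of an element of degree `-2` of `sE`. -/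
theorem H0mk_eq_of_rel {X Y : Ob} {a b : Z0 C B X Y} {x y z : E C B .tree X Y}
    (ha : (a : sD C B X Y) = toD C B X Y x) (hb : (b : sD C B X Y) = toD C B X Y y)
    (hz : z ∈ gr C B .tree X Y (-2)) (h : Rel (dE z - (x - y))) :
    H0mk C B a = H0mk C B b := by
  refine (H0mk_eq _ _).2 ⟨toD C B X Y z, ⟨_, hz, rfl⟩, ?_⟩
  rw [b₁_toD, ha, hb, ← map_sub, toD_eq]
  exact h

/-- The differential of a binary product of tree monomials. -/
theorem dT_node_sing {X Y Z : Ob} (s : T C B .tree X Y) (t : T C B .tree Y Z) :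
    dT (.node s (.sing t)) =
      -(nodeE (bas s) (singE (dT t)) + sgn k t.deg • nodeE (dT s) (bas (.sing t))) := by
  simp only [dT, T.splitSum, T.deg, add_zero]

/-- The differential of a ternary product of tree monomials. -/
theorem dT_node_cons_sing {X Y Z W : Ob} (r : T C B .tree X Y) (s : T C B .tree Y Z)
    (t : T C B .tree Z W) :
    dT (.node r (.cons s (.sing t))) =
      -(nodeE (bas r) (consE (bas s) (singE (dT t))) +
        sgn k t.deg • nodeE (bas r) (consE (dT s) (bas (.sing t))) +
        bas (.node r (.sing (.node s (.sing t)))) +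
        sgn k (s.deg + t.deg) • nodeE (dT r) (bas (.cons s (.sing t))) +
        sgn k t.deg • bas (.node (.node r (.sing s)) (.sing t))) := by
  simp only [dT, T.splitSum, T.deg, add_zero, map_add, map_smul, nodeE_bas]

/-! ### Morphisms with a cone in `B` become invertible -/

/-- The tree `(j ⊗ H(1_K)) b₂`, for `j : Y → K` of degree `0` and `K` in `B`.  If `j` is closed,
its differential is `-j` modulo the relations. -/
abbrev wTree {Y K : Ob} (hK : B K) (j : C.Hom Y K 0) : T C B .tree Y K :=
  .node (.leaf 0 j) (.sing (.hmt (.inl hK) (uT C B K)))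

/-- The tree `(H(1_K) ⊗ f) b₂`, for `f : K → X` of degree `1` and `K` in `B`.  If `f` is closed,
its differential is `f` modulo the relations. -/
abbrev vTree {K X : Ob} (hK : B K) (f : C.Hom K X 1) : T C B .tree K X :=
  .node (.hmt (.inl hK) (uT C B K)) (.sing (.leaf 1 f))

theorem rel_dT_wTree {Y K : Ob} (hK : B K) {j : C.Hom Y K 0} (hj : C.d 0 1 (zero_add 1) j = 0) :
    Rel (dT (wTree hK j) + bas (.leaf 0 j)) := by
  have h1 := (((rel_dT_u (C := C) (B := B) K).hmt (.inl hK)).sing).node_right (bas (.leaf 0 j))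
  have h2 := (rel_dT_leaf (B := B) _ hj).node_left _ (bas (.sing (.hmt (.inl hK) (uT C B K))))
  have h3 := Rel.mul_two' (B := B) 0 0 0 (zero_add 0) j (C.one K)
  rw [C.comp_one] at h3
  refine ((h1.sub h3).sub (h2.smul (sgn k (-2)) _)).congr ?_
  rw [dT_node_sing, show dT (T.hmt (.inl hK) (uT C B K)) = bas (uT C B K) -
    hmtE (.inl hK) (dT (uT C B K)) from rfl, show (T.hmt (.inl hK) (uT C B K)).deg = -2 from rfl]
  simp only [map_sub, singE_bas, nodeE_bas, sgn_zero]
  module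

theorem rel_dT_vTree {K X : Ob} (hK : B K) {f : C.Hom K X 1}
    (hf : C.d 1 2 (by norm_num) f = 0) :
    Rel (dT (vTree hK f) - bas (.leaf 1 f)) := by
  have h1 := ((rel_dT_leaf (B := B) _ hf).sing).node_right (bas (.hmt (.inl hK) (uT C B K)))
  have h2 := ((rel_dT_u (C := C) (B := B) K).hmt (.inl hK)).node_left _ (bas (.sing (.leaf 1 f)))
  have h3 := Rel.mul_two' (B := B) 0 1 1 (zero_add 1) (C.one K) f
  rw [C.one_comp] at h3
  refine ((h2.sub h1).sub h3).congr ?_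
  rw [dT_node_sing, show dT (T.hmt (.inl hK) (uT C B K)) = bas (uT C B K) -
    hmtE (.inl hK) (dT (uT C B K)) from rfl, show (T.leaf (B := B) 1 f).deg = 0 from rfl]
  simp only [map_sub, LinearMap.sub_apply, nodeE_bas, sgn_one, sgn_zero]
  module

/-- A tree monomial of degree `-1` which is closed modulo the relations, as a cycle of `D`. -/
noncomputable def cycleOfTree {X Y : Ob} (t : T C B .tree X Y) (h : t.deg = -1)
    (ht : Rel (dT t)) : Z0 C B X Y :=
  ⟨toD C B X Y (bas t), ⟨_, gr_congr (bas_gr _) h, rfl⟩, by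
    change b₁ C B X Y (toD C B X Y _) = 0
    rwa [b₁_toD, dE_bas, toD_eq_zero]⟩

/-- `((j ⊗ H(1_K)) b₂ ⊗ f) b₂` is closed when `j f = 0`. -/
theorem rel_dT_wTree_mul {X Y K : Ob} (hK : B K) {j : C.Hom Y K 0} (hj : C.d 0 1 (zero_add 1) j = 0)
    {f : C.Hom K X 1} (hf : C.d 1 2 (by norm_num) f = 0) (hjf : C.comp (zero_add 1) j f = 0) :
    Rel (dT (T.node (wTree hK j) (.sing (.leaf 1 f)))) := by
  have h1 := ((rel_dT_leaf (B := B) _ hf).sing).node_right (bas (wTree hK j))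
  have h2 := (rel_dT_wTree hK hj).node_left _ (bas (.sing (.leaf 1 f)))
  have h3 := Rel.mul_two' (B := B) 0 1 1 (zero_add 1) j f
  rw [hjf] at h3
  have h4 := (rel_leaf_zero (C := C) (B := B) (X := Y) (Y := X) 1)
  refine (((h1.neg.sub h2).add _ _ h3).sub h4).congr ?_
  rw [dT_node_sing, show (T.leaf (B := B) 1 f).deg = 0 from rfl]
  simp only [map_add, LinearMap.add_apply, nodeE_bas, sgn_one, sgn_zero]
  module

/-- `(j ⊗ (H(1_K) ⊗ f) b₂) b₂` is closed when `j f = 0`. -/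
theorem rel_dT_mul_vTree {X Y K : Ob} (hK : B K) {j : C.Hom Y K 0} (hj : C.d 0 1 (zero_add 1) j = 0)
    {f : C.Hom K X 1} (hf : C.d 1 2 (by norm_num) f = 0) (hjf : C.comp (zero_add 1) j f = 0) :
    Rel (dT (T.node (.leaf 0 j) (.sing (vTree hK f)))) := by
  have h1 := ((rel_dT_vTree hK hf).sing).node_right (bas (.leaf 0 j))
  have h2 := (rel_dT_leaf (B := B) _ hj).node_left _ (bas (.sing (vTree hK f)))
  have h3 := Rel.mul_two' (B := B) 0 1 1 (zero_add 1) j f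
  rw [hjf] at h3
  have h4 := (rel_leaf_zero (C := C) (B := B) (X := Y) (Y := X) 1)
  refine (((h1.neg.sub (h2.smul (sgn k (vTree (B := B) hK f).deg) _)).sub h3).add _ _ h4).congr ?_
  rw [dT_node_sing]
  simp only [map_sub, nodeE_bas, singE_bas, sgn_one]
  module

/-- A left inverse of `q`, in the order of the arrows.  The homotopy that witnesses it is
`(w ⊗ f ⊗ q) b₃ + (w ⊗ s) b₂` with `w = (j ⊗ H(1_K)) b₂`: the first summand moves `q` into the
second factor of `(w ⊗ f) b₂` (the term with `w b₁ = -j` vanishes, since `b₃` of `C` is zero), and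
the second one uses that `f q` is a boundary. -/
theorem exists_leftInverse_H0mk_eZ {X Y K : Ob} {q : C.Hom X Y 0} (hq : C.d 0 1 (zero_add 1) q = 0)
    (hK : B K) {j : C.Hom Y K 0} (hj : C.d 0 1 (zero_add 1) j = 0)
    {f : C.Hom K X 1} (hf : C.d 1 2 (by norm_num) f = 0) (hjf : C.comp (zero_add 1) j f = 0)
    {s : C.Hom K Y 0} (hjs : C.comp (zero_add 0) j s = C.one Y)
    (hs : C.d 0 1 (zero_add 1) s = -C.comp (add_zero 1) f q) :
    ∃ p : Z0 C B Y X, H0mk C B (mulZ p (eZ q hq)) = H0mk C B (eZ (C.one Y) (C.d_one Y)) := by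
  refine ⟨cycleOfTree (T.node (wTree hK j) (.sing (.leaf 1 f))) rfl
    (rel_dT_wTree_mul hK hj hf hjf), ?_⟩
  refine H0mk_eq_of_rel
    (x := bas (.node (.node (wTree hK j) (.sing (.leaf 1 f))) (.sing (.leaf 0 q))))
    (y := bas (uT C B Y))
    (z := bas (.node (wTree hK j) (.cons (.leaf 1 f) (.sing (.leaf 0 q)))) +
      bas (.node (wTree hK j) (.sing (.leaf 0 s)))) ?_ rfl
    (Submodule.add_mem _ (gr_congr (bas_gr _) rfl) (gr_congr (bas_gr _) rfl)) ?_
  · simp [cycleOfTree, eZ, mulZ]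
  have w := rel_dT_wTree (B := B) hK hj
  -- the terms of the differential of the ternary product
  have a1 := ((rel_dT_leaf (B := B) _ hq).sing.cons_right (bas (.leaf 1 f)) _).node_right
    (bas (wTree hK j))
  have a2 := ((rel_dT_leaf (B := B) _ hf).cons_left _ (bas (.sing (.leaf 0 q)))).node_right
    (bas (wTree hK j))
  have a3 := ((Rel.mul_two' (B := B) 1 0 1 (add_zero 1) f q).sing).node_right (bas (wTree hK j))
  have a4 := w.node_left _ (bas (.cons (.leaf 1 f) (.sing (.leaf 0 q))))
  have a5 := Rel.mul_many (B := B) 0 1 j f (.sing (.leaf 0 q)) trivial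
  -- the terms of the differential of the binary product
  have b1 := ((Rel.leaf_smul (B := B) 1 (-1) (C.comp (add_zero 1) f q)).sing).node_right
    (bas (wTree hK j))
  have b2 := w.node_left _ (bas (.sing (.leaf 0 s)))
  have b3 := Rel.mul_two' (B := B) 0 0 0 (zero_add 0) j s
  rw [hjs] at b3
  rw [map_add, dE_bas, dE_bas, dT_node_cons_sing, dT_node_sing (wTree hK j),
    dT_leaf 0 1 (zero_add 1) s, hs, ← neg_one_smul k (C.comp _ f q)]
  refine (((((((a1.neg.add _ _ a2).sub a3).add _ _ a4).sub a5).sub b1).add _ _ b2).sub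
    b3).congr ?_
  rw [show (T.leaf (B := B) 0 q).deg = -1 from rfl, show (T.leaf (B := B) 0 s).deg = -1 from rfl,
    show (T.leaf (B := B) 1 f).deg = 0 from rfl]
  simp only [map_add, map_sub, map_smul, LinearMap.add_apply, nodeE_bas, singE_bas,
    sgn_neg_one, sgn_zero, zero_add]
  module

/-- A right inverse of `q`, in the order of the arrows.  The homotopy that witnesses it is
`(q ⊗ j ⊗ v) b₃ - (i ⊗ v) b₂` with `v = (H(1_K) ⊗ f) b₂`, for reasons dual to those of
`exists_leftInverse_H0mk_eZ`. -/
theorem exists_rightInverse_H0mk_eZ {X Y K : Ob} {q : C.Hom X Y 0} (hq : C.d 0 1 (zero_add 1) q = 0)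
    (hK : B K) {j : C.Hom Y K 0} (hj : C.d 0 1 (zero_add 1) j = 0)
    {f : C.Hom K X 1} (hf : C.d 1 2 (by norm_num) f = 0) (hjf : C.comp (zero_add 1) j f = 0)
    {i : C.Hom X K (-1)} (hif : C.comp (neg_add_cancel 1) i f = C.one X)
    (hi : C.d (-1) 0 (neg_add_cancel 1) i = C.comp (zero_add 0) q j) :
    ∃ p : Z0 C B Y X, H0mk C B (mulZ (eZ q hq) p) = H0mk C B (eZ (C.one X) (C.d_one X)) := by
  -- The minus sign comes from the homotopy `(j ⊗ H(1_K) ⊗ f) b₃` between the two bracketings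
  refine ⟨-cycleOfTree (T.node (.leaf 0 j) (.sing (vTree hK f))) rfl
    (rel_dT_mul_vTree hK hj hf hjf), ?_⟩
  refine H0mk_eq_of_rel
    (x := -bas (.node (.leaf 0 q) (.sing (.node (.leaf 0 j) (.sing (vTree hK f))))))
    (y := bas (uT C B X))
    (z := bas (.node (.leaf 0 q) (.cons (.leaf 0 j) (.sing (vTree hK f)))) -
      bas (.node (.leaf (-1) i) (.sing (vTree hK f)))) ?_ rfl
    (Submodule.sub_mem _ (gr_congr (bas_gr _) rfl) (gr_congr (bas_gr _) rfl)) ?_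
  · simp [cycleOfTree, eZ, mulZ]
  have v := rel_dT_vTree (B := B) hK hf
  -- the terms of the differential of the ternary product
  have a1 := (v.sing.cons_right (bas (.leaf 0 j)) _).node_right (bas (.leaf 0 q))
  have a2 := ((rel_dT_leaf (B := B) _ hj).cons_left _ (bas (.sing (vTree hK f)))).node_right
    (bas (.leaf 0 q))
  have a3 := (rel_dT_leaf (B := B) _ hq).node_left _ (bas (.cons (.leaf 0 j) (.sing (vTree hK f))))
  have a4 := (Rel.mul_two' (B := B) 0 0 0 (zero_add 0) q j).node_left _ (bas (.sing (vTree hK f)))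
  have a5 := Rel.mul_many (B := B) 0 0 q j (.sing (.leaf 1 f)) trivial
  -- the terms of the differential of the binary product
  have b1 := (v.sing).node_right (bas (.leaf (-1) i))
  have b2 := Rel.mul_two' (B := B) (-1) 1 0 (neg_add_cancel 1) i f
  rw [hif] at b2
  rw [map_sub, dE_bas, dE_bas, dT_node_cons_sing, dT_node_sing _ (vTree hK f),
    dT_leaf (-1) 0 (neg_add_cancel 1) i, hi]
  refine ((((((a1.neg.sub a5).add _ _ a2).sub a3).add _ _ a4).add _ _ b1).add _ _ b2).congr ?_
  rw [show (T.leaf (B := B) 0 j).deg = -1 from rfl, show (vTree (B := B) hK f).deg = -1 from rfl]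
  simp only [map_sub, map_smul, LinearMap.sub_apply, LinearMap.smul_apply, nodeE_bas, singE_bas,
    consE_bas, sgn_neg_one, sgn_one, sgn_zero, sgn_add]
  module

end

/-! ### Quasi-isomorphisms of complexes -/

section

variable (k : Type w) [CommRing k] {A : Type u} [Category.{v} A] [Abelian A] [Linear k A]

open CochainComplex CochainComplex.HomComplex

theorem acyclic_mappingCone {X Y : CochainComplex A ℤ} (q : X ⟶ Y) (hq : QuasiIso q) :
    HomologicalComplex.Acyclic (mappingCone q) := by
  have h : HomotopyCategory.quasiIso A (ComplexShape.up ℤ)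
      ((HomotopyCategory.quotient A (ComplexShape.up ℤ)).map q) := by
    rwa [HomotopyCategory.quotient_map_mem_quasiIso_iff, HomologicalComplex.mem_quasiIso_iff]
  rw [HomotopyCategory.quasiIso_eq_trW_subcategoryAcyclic] at h
  exact (HomotopyCategory.quotient_obj_mem_subcategoryAcyclic_iff_acyclic _).1
    (((HomotopyCategory.subcategoryAcyclic A).trW_iff_of_distinguished _
      (HomotopyCategory.mappingCone_triangleh_distinguished q)).1 h)

/-- The homotopy class of a quasi-isomorphism is split mono and split epi in `H⁰D`, by the
contractibility of its cone in `D`. -/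
theorem isIso_H0e_map_of_quasiIso {X Y : CochainComplex A ℤ} (q : X ⟶ Y) (hq : QuasiIso q) :
    IsIso ((H0e k A).map ((HomotopyCategory.quotient A (ComplexShape.up ℤ)).map q)) := by
  have hK := acyclic_mappingCone q hq
  obtain ⟨p, hp⟩ := exists_leftInverse_H0mk_eZ (C := complexes k A)
    (B := fun K => HomologicalComplex.Acyclic K) (X := X) (Y := Y) (K := mappingCone q)
    (q := Cochain.ofHom q) (δ_ofHom q) hK (j := Cochain.ofHom (mappingCone.inr q)) (δ_ofHom _)
    (f := (mappingCone.fst q).1) ((mappingCone.fst q).δ_eq_zero 2) (mappingCone.inr_fst q)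
    (s := mappingCone.snd q) (mappingCone.inr_snd q) (mappingCone.δ_snd q)
  obtain ⟨p', hp'⟩ := exists_rightInverse_H0mk_eZ (C := complexes k A)
    (B := fun K => HomologicalComplex.Acyclic K) (X := X) (Y := Y) (K := mappingCone q)
    (q := Cochain.ofHom q) (δ_ofHom q) hK (j := Cochain.ofHom (mappingCone.inr q)) (δ_ofHom _)
    (f := (mappingCone.fst q).1) ((mappingCone.fst q).δ_eq_zero 2) (mappingCone.inr_fst q)
    (i := mappingCone.inl q) (mappingCone.inl_fst q)
    ((mappingCone.δ_inl q).trans (Cochain.ofHom_comp _ _))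
  have : IsSplitEpi ((H0e k A).map ((HomotopyCategory.quotient A (ComplexShape.up ℤ)).map q)) :=
    ⟨⟨⟨H0mk _ _ p, hp⟩⟩⟩
  have : IsSplitMono ((H0e k A).map ((HomotopyCategory.quotient A (ComplexShape.up ℤ)).map q)) :=
    ⟨⟨⟨H0mk _ _ p', hp'⟩⟩⟩
  exact isIso_of_mono_of_isSplitEpi _

/-- `H⁰e` inverts the morphisms with acyclic cone, as these are the classes of quasi-isomorphisms. -/
theorem H0e_inverts_trW :
    (HomotopyCategory.subcategoryAcyclic A).trW.IsInvertedBy (H0e k A) := by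
  intro X Y f hf
  obtain ⟨q, rfl⟩ := (HomotopyCategory.quotient A (ComplexShape.up ℤ)).map_surjective f
  rw [← HomotopyCategory.quasiIso_eq_trW_subcategoryAcyclic] at hf
  exact isIso_H0e_map_of_quasiIso k q ((HomologicalComplex.mem_quasiIso_iff q).1
    ((HomotopyCategory.quotient_map_mem_quasiIso_iff q).1 hf))

end

end DGCat

theorem mainTheorem10 {k : Type w} [CommRing k] {A : Type u} [Category.{v} A] [Abelian A]
    [Linear k A] [HasDerivedCategory.{t} A] :
    (∀ (X Y : CochainComplex A ℤ) (q : X ⟶ Y), QuasiIso q →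
      IsIso ((DGCat.H0e k A).map ((HomotopyCategory.quotient A (ComplexShape.up ℤ)).map q))) ∧
    (∃ F : DGCat.VerdierQuotient A ≌ DerivedCategory A,
      Nonempty (DGCat.verdierQ A ⋙ F.functor ≅ DerivedCategory.Qh)) ∧
    ∃ g : DGCat.VerdierQuotient A ⥤
        DGCat.H0 (DGCat.complexes k A) (fun K => HomologicalComplex.Acyclic K),
      DGCat.H0e k A = DGCat.verdierQ A ⋙ g ∧
      ∀ X : CochainComplex A ℤ,
        g.obj ((DGCat.verdierQ A).obj ((HomotopyCategory.quotient A (ComplexShape.up ℤ)).obj X)) =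
          ⟨X⟩ := by
  refine ⟨fun X Y q hq => DGCat.isIso_H0e_map_of_quasiIso k q hq,
    ⟨Localization.uniq (DGCat.verdierQ A) DerivedCategory.Qh
      (HomotopyCategory.subcategoryAcyclic A).trW, ⟨Localization.compUniqFunctor _ _ _⟩⟩,
    Localization.Construction.lift (DGCat.H0e k A) (DGCat.H0e_inverts_trW k),
    (Localization.Construction.fac _ _).symm, fun X => rfl⟩
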